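/- Let $X$ be a compact, simply connected (in particular connected) complex manifold of complex dimension $d\ge 1$. For a connected complex Lie group $G$ with Lie algebra $\mathfrak g$ and a connected complex Lie subgroup $H\subset G$ with Lie algebra $\mathfrak h$, a *branched holomorphic Cartan geometry of type $G/H$* on $X$ is a pair $(E_H,\beta)$, where $E_H\to X$ is a holomorphic principal $H$-bundle and $\beta$ is a holomorphic $\mathfrak g$-valued one-form on the total space $E_H$ such that (1) $\beta_p: T_pE_H\to\mathfrak g$ is an isomorphism for all $p$ lying over some nonempty open subset of $X$; (2) $\beta$ is $H$-equivariant, $R_h^*\beta=\mathrm{Ad}(h^{-1})\beta$ for $h\in H$; (3) $\beta$ maps the fundamental vector field of each $w\in\mathfrak h$ to $w$. It is *flat* if $d\beta+\tfrac12[\beta\wedge\beta]=0$. A *branched (flat) holomorphic affine structure* on $X$ is a branched (flat) holomorphic Cartan geometry of type $(\mathbb C^d\rtimes \mathrm{GL}(d,\mathbb C))/\mathrm{GL}(d,\mathbb C)$. A *branched (flat) holomorphic projective structure* on $X$ is a branched (flat) holomorphic Cartan geometry of type $\mathrm{PGL}(d+1,\mathbb C)/Q$, where $Q$ is the stabilizer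 of a point of $\mathbb CP^d$. The manifold $X$ is *Moishezon* if it carries $d$ algebraically independent meromorphic functions (that is, if its algebraic dimension is $d$). Then: (i) $X$ does not admit any branched flat holomorphic affine structure. (ii) If $X$ admits a branched flat holomorphic projective structure, then $X$ is Moishezon. -/

import Mathlib

open scoped Manifold ContDiff LinearAlgebra.Projectivization

universe u v

namespace BranchedCartan

noncomputable section

/-! ### Meromorphic functions and Moishezon manifolds -/

/-- The filter generated by the dense open subsets of `X`. -/
def denseOpens (X : Type u) [TopologicalSpace X] : Filter X where
  sets := {s | ∃ U : Set X, IsOpen U ∧ Dense U ∧ U ⊆ s}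
  univ_sets := ⟨Set.univ, isOpen_univ, dense_univ, le_rfl⟩
  sets_of_superset := by
    rintro s t ⟨U, hU, hd, hs⟩ hst
    exact ⟨U, hU, hd, hs.trans hst⟩
  inter_sets := by
    rintro s t ⟨U, hU, hd, hs⟩ ⟨U', hU', hd', hs'⟩
    exact ⟨U ∩ U', hU.inter hU', hd.inter_of_isOpen_left hd' hU, Set.inter_subset_inter hs hs'⟩

/-- The `ℂ`-algebra of germs along the dense open sets: functions `X → ℂ` modulo equality on
a dense open set. -/
instance (X : Type u) [TopologicalSpace X] : Algebra ℂ ((denseOpens X).Germ ℂ) :=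
  Algebra.ofModule
    (fun r x y => by
      induction x using Filter.Germ.inductionOn with | _ f =>
      induction y using Filter.Germ.inductionOn with | _ g =>
      rw [← Filter.Germ.coe_smul, ← Filter.Germ.coe_mul, ← Filter.Germ.coe_mul,
        ← Filter.Germ.coe_smul, smul_mul_assoc])
    (fun r x y => by
      induction x using Filter.Germ.inductionOn with | _ f =>
      induction y using Filter.Germ.inductionOn with | _ g =>
      rw [← Filter.Germ.coe_smul, ← Filter.Germ.coe_mul, ← Filter.Germ.coe_mul,
        ← Filter.Germ.coe_smul, mul_smul_comm])

/-- `f` is meromorphic on the `d`-dimensional complex manifold `X`: near every point it is a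
quotient `p / q` of holomorphic functions, where `q` does not vanish identically on any nonempty
open set. The values of `f` matter only on a dense open set. -/
def IsMeromorphic (d : ℕ) {X : Type u} [TopologicalSpace X] [ChartedSpace (Fin d → ℂ) X]
    (f : X → ℂ) : Prop :=
  ∀ x : X, ∃ U : Set X, IsOpen U ∧ x ∈ U ∧ ∃ p q : X → ℂ,
    ContMDiffOn 𝓘(ℂ, Fin d → ℂ) 𝓘(ℂ, ℂ) ω p U ∧ ContMDiffOn 𝓘(ℂ, Fin d → ℂ) 𝓘(ℂ, ℂ) ω q U ∧
    U ⊆ closure {y | y ∈ U ∧ q y ≠ 0} ∧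
    ∀ᶠ y in denseOpens X, y ∈ U → f y * q y = p y

section

variable {d : ℕ} {X : Type u} [TopologicalSpace X] [ChartedSpace (Fin d → ℂ) X]

theorem subset_closure_mul {U U' : Set X} {q q' : X → ℂ} (hU : IsOpen U) (hU' : IsOpen U')
    (hq : ContinuousOn q U) (h : U ⊆ closure {y | y ∈ U ∧ q y ≠ 0})
    (h' : U' ⊆ closure {y | y ∈ U' ∧ q' y ≠ 0}) :
    U ∩ U' ⊆ closure {y | y ∈ U ∩ U' ∧ q y * q' y ≠ 0} := by
  rintro y ⟨hy, hy'⟩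
  rw [mem_closure_iff]
  intro N hN hyN
  obtain ⟨z, ⟨hzN, hzU'⟩, hzU, hz⟩ :=
    mem_closure_iff.1 (h hy) (N ∩ U') (hN.inter hU') ⟨hyN, hy'⟩
  have hopen : IsOpen (U ∩ q ⁻¹' {0}ᶜ) := hq.isOpen_inter_preimage hU isOpen_compl_singleton
  obtain ⟨t, ⟨htN, htU, htq⟩, htU', ht⟩ :=
    mem_closure_iff.1 (h' hzU') (N ∩ (U ∩ q ⁻¹' {0}ᶜ)) (hN.inter hopen) ⟨hzN, hzU, hz⟩
  exact ⟨t, htN, ⟨htU, htU'⟩, mul_ne_zero htq ht⟩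

theorem isMeromorphic_const (c : ℂ) : IsMeromorphic d (fun _ : X => c) := fun x =>
  ⟨Set.univ, isOpen_univ, Set.mem_univ x, fun _ => c, fun _ => 1, contMDiffOn_const,
    contMDiffOn_const, by simp, by simp⟩

theorem IsMeromorphic.add {f g : X → ℂ} (hf : IsMeromorphic d f) (hg : IsMeromorphic d g) :
    IsMeromorphic d (f + g) := by
  intro x
  obtain ⟨U, hU, hx, p, q, hp, hq, hd, he⟩ := hf x
  obtain ⟨U', hU', hx', p', q', hp', hq', hd', he'⟩ := hg x
  have l := Set.inter_subset_left (s := U) (t := U')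
  have r := Set.inter_subset_right (s := U) (t := U')
  refine ⟨U ∩ U', hU.inter hU', ⟨hx, hx'⟩, p * q' + p' * q, q * q',
    ((hp.mono l).mul (hq'.mono r)).add ((hp'.mono r).mul (hq.mono l)),
    (hq.mono l).mul (hq'.mono r), subset_closure_mul hU hU' hq.continuousOn hd hd', ?_⟩
  filter_upwards [he, he'] with y hy hy' hyU
  simp only [Pi.add_apply, Pi.mul_apply, ← hy hyU.1, ← hy' hyU.2]
  ring

theorem IsMeromorphic.mul {f g : X → ℂ} (hf : IsMeromorphic d f) (hg : IsMeromorphic d g) :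
    IsMeromorphic d (f * g) := by
  intro x
  obtain ⟨U, hU, hx, p, q, hp, hq, hd, he⟩ := hf x
  obtain ⟨U', hU', hx', p', q', hp', hq', hd', he'⟩ := hg x
  have l := Set.inter_subset_left (s := U) (t := U')
  have r := Set.inter_subset_right (s := U) (t := U')
  refine ⟨U ∩ U', hU.inter hU', ⟨hx, hx'⟩, p * p', q * q',
    (hp.mono l).mul (hp'.mono r),
    (hq.mono l).mul (hq'.mono r), subset_closure_mul hU hU' hq.continuousOn hd hd', ?_⟩
  filter_upwards [he, he'] with y hy hy' hyU
  simp only [Pi.mul_apply, ← hy hyU.1, ← hy' hyU.2]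
  ring

end

/-- The `ℂ`-algebra of meromorphic functions of a `d`-dimensional complex manifold `X`, two
meromorphic functions being identified if they agree on a dense open set. -/
def meromorphicFunctions (d : ℕ) (X : Type u) [TopologicalSpace X] [ChartedSpace (Fin d → ℂ) X] :
    Subalgebra ℂ ((denseOpens X).Germ ℂ) where
  carrier := {F | ∃ f : X → ℂ, IsMeromorphic d f ∧ F = (f : (denseOpens X).Germ ℂ)}
  mul_mem' := by
    rintro _ _ ⟨f, hf, rfl⟩ ⟨g, hg, rfl⟩
    exact ⟨f * g, hf.mul hg, rfl⟩
  add_mem' := by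
    rintro _ _ ⟨f, hf, rfl⟩ ⟨g, hg, rfl⟩
    exact ⟨f + g, hf.add hg, rfl⟩
  algebraMap_mem' c := ⟨fun _ => c, isMeromorphic_const c, by
    rw [Algebra.algebraMap_eq_smul_one, ← Filter.Germ.coe_one, ← Filter.Germ.coe_smul]
    congr 1
    ext
    simp⟩

/-- A (compact, connected) complex manifold of dimension `d` is Moishezon if it carries `d`
algebraically independent meromorphic functions. -/
def IsMoishezon (d : ℕ) (X : Type u) [TopologicalSpace X] [ChartedSpace (Fin d → ℂ) X] : Prop :=
  ∃ f : Fin d → meromorphicFunctions d X, AlgebraicIndependent ℂ f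

/-! ### Holomorphic principal bundles -/

/-- A holomorphic principal bundle, with structure group the complex Lie group `H` (modelled on
the normed space `F`), over the `d`-dimensional complex manifold `X`: a complex manifold
`Total` with a holomorphic projection onto `X` and a holomorphic right action of `H`, which is
locally over `X` biholomorphic to the product with `H`, compatibly with right translations. -/
structure HolomorphicPrincipalBundle (d : ℕ) (X : Type u) [TopologicalSpace X]
    [ChartedSpace (Fin d → ℂ) X] (F : Type) [NormedAddCommGroup F] [NormedSpace ℂ F]
    (H : Type) [Group H] [TopologicalSpace H] [ChartedSpace F H] where
  Total : Type v
  [topologicalSpace : TopologicalSpace Total]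
  [chartedSpace : ChartedSpace ((Fin d → ℂ) × F) Total]
  [isManifold : IsManifold 𝓘(ℂ, (Fin d → ℂ) × F) ω Total]
  proj : Total → X
  contMDiff_proj : ContMDiff 𝓘(ℂ, (Fin d → ℂ) × F) 𝓘(ℂ, Fin d → ℂ) ω proj
  act : Total → H → Total
  contMDiff_act : ContMDiff (𝓘(ℂ, (Fin d → ℂ) × F).prod 𝓘(ℂ, F)) 𝓘(ℂ, (Fin d → ℂ) × F) ω
    (fun y : Total × H => act y.1 y.2)
  act_one : ∀ p, act p 1 = p
  act_mul : ∀ p h k, act p (h * k) = act (act p h) k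
  proj_act : ∀ p h, proj (act p h) = proj p
  locallyTrivial : ∀ x : X, ∃ e : Bundle.Trivialization H proj, x ∈ e.baseSet ∧
    ContMDiffOn 𝓘(ℂ, (Fin d → ℂ) × F) (𝓘(ℂ, Fin d → ℂ).prod 𝓘(ℂ, F)) ω e e.source ∧
    ContMDiffOn (𝓘(ℂ, Fin d → ℂ).prod 𝓘(ℂ, F)) 𝓘(ℂ, (Fin d → ℂ) × F) ω
      e.toOpenPartialHomeomorph.symm e.target ∧
    ∀ p ∈ e.source, ∀ h, e (act p h) = ((e p).1, (e p).2 * h)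

attribute [instance] HolomorphicPrincipalBundle.topologicalSpace
  HolomorphicPrincipalBundle.chartedSpace HolomorphicPrincipalBundle.isManifold

/-! ### Branched holomorphic Cartan geometries -/

/-- The infinitesimal data of a homogeneous space `G / H` that enter a Cartan geometry of type
`G / H`: the Lie algebra `𝔤` of `G` (realized as a Lie algebra of operators on a vector space
`W`, with the commutator as bracket), the restriction to `H` of the adjoint action, and the map `Lie H → 𝔤` induced by the
inclusion of `H` into `G`. Here `Lie H = T₁H` is identified with the model space `F` of `H`
by the chart at the identity. -/
structure KleinModel (F : Type) [NormedAddCommGroup F] [NormedSpace ℂ F]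
    (H : Type) [Group H] (W : Type) [NormedAddCommGroup W] [NormedSpace ℂ W] where
  lieAlg : Submodule ℂ (W →L[ℂ] W)
  lie_mem : ∀ M ∈ lieAlg, ∀ N ∈ lieAlg, M * N - N * M ∈ lieAlg
  Ad : H →* Module.End ℂ (W →L[ℂ] W)
  Ad_mem : ∀ h, ∀ M ∈ lieAlg, Ad h M ∈ lieAlg
  incl : F →ₗ[ℂ] (W →L[ℂ] W)
  incl_mem : ∀ w, incl w ∈ lieAlg

/-- A branched holomorphic Cartan geometry on `X` whose type is the Klein model `m`: a holomorphic
principal `H`-bundle `E` with a holomorphic `𝔤`-valued one-form `β` on its total space which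
* is an isomorphism `T_p E → 𝔤` at all points `p` over some nonempty open subset of `X`,
* is `H`-equivariant, and
* restricts to the Maurer-Cartan form on the fibers, i.e. it maps the fundamental vector field
  of `w ∈ Lie H` to `w`. -/
structure BranchedCartanGeometry (d : ℕ) (X : Type u) [TopologicalSpace X]
    [ChartedSpace (Fin d → ℂ) X] {F : Type} [NormedAddCommGroup F] [NormedSpace ℂ F]
    {H : Type} [Group H] [TopologicalSpace H] [ChartedSpace F H]
    {W : Type} [NormedAddCommGroup W] [NormedSpace ℂ W] (m : KleinModel F H W) where
  bundle : HolomorphicPrincipalBundle.{u, v} d X F H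
  form : ∀ p : bundle.Total, TangentSpace 𝓘(ℂ, (Fin d → ℂ) × F) p →L[ℂ] (W →L[ℂ] W)
  form_mem : ∀ p v, form p v ∈ m.lieAlg
  holomorphic : ContMDiff 𝓘(ℂ, (Fin d → ℂ) × F).tangent 𝓘(ℂ, W →L[ℂ] W) ω
    (fun v : TangentBundle 𝓘(ℂ, (Fin d → ℂ) × F) bundle.Total => form v.proj v.snd)
  generically_iso : ∃ U : Set X, IsOpen U ∧ U.Nonempty ∧ ∀ p : bundle.Total, bundle.proj p ∈ U →
    Function.Injective (form p) ∧ Set.range (form p) = (m.lieAlg : Set (W →L[ℂ] W))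
  equivariant : ∀ (h : H) (p : bundle.Total) (v : TangentSpace 𝓘(ℂ, (Fin d → ℂ) × F) p),
    form (bundle.act p h)
      (mfderiv 𝓘(ℂ, (Fin d → ℂ) × F) 𝓘(ℂ, (Fin d → ℂ) × F) (fun y => bundle.act y h) p v) =
        m.Ad h⁻¹ (form p v)
  vertical : ∀ (p : bundle.Total) (w : F),
    form (bundle.act p 1)
      (mfderiv 𝓘(ℂ, F) 𝓘(ℂ, (Fin d → ℂ) × F) (fun h : H => bundle.act p h) 1 w) = m.incl w

namespace BranchedCartanGeometry

variable {d : ℕ} {X : Type u} [TopologicalSpace X]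
  [ChartedSpace (Fin d → ℂ) X] {F : Type} [NormedAddCommGroup F] [NormedSpace ℂ F]
  {H : Type} [Group H] [TopologicalSpace H] [ChartedSpace F H]
  {W : Type} [NormedAddCommGroup W] [NormedSpace ℂ W] {m : KleinModel F H W}

/-- The one-form of the geometry, read in the chart of the total space around `p`: the pullback
by the inverse of the chart. -/
def formInChart (S : BranchedCartanGeometry.{u, v} d X m) (p : S.bundle.Total)
    (y : (Fin d → ℂ) × F) : ((Fin d → ℂ) × F) →L[ℂ] (W →L[ℂ] W) :=
  (S.form ((chartAt ((Fin d → ℂ) × F) p).symm y)).comp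
    (mfderiv 𝓘(ℂ, (Fin d → ℂ) × F) 𝓘(ℂ, (Fin d → ℂ) × F)
      (chartAt ((Fin d → ℂ) × F) p).symm y)

/-- The geometry is flat if its curvature `dβ + ½ [β ∧ β]` vanishes, i.e. if
`dβ(v, w) + [β v, β w] = 0` in all charts of the total space. -/
def IsFlat (S : BranchedCartanGeometry.{u, v} d X m) : Prop :=
  ∀ p : S.bundle.Total, ∀ y ∈ (chartAt ((Fin d → ℂ) × F) p).target, ∀ v w : (Fin d → ℂ) × F,
    fderiv ℂ (S.formInChart p) y v w - fderiv ℂ (S.formInChart p) y w v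
      + (S.formInChart p y v * S.formInChart p y w - S.formInChart p y w * S.formInChart p y v) = 0

end BranchedCartanGeometry

/-! ### The affine and the projective model -/

/-- The vector space `ℂ^d`. -/
abbrev V (d : ℕ) : Type := Fin d → ℂ

/-- The vector space `ℂ^(d+1) = ℂ × ℂ^d`. -/
abbrev W (d : ℕ) : Type := ℂ × V d

/-- The general linear group of `ℂ^d`. -/
abbrev GLV (d : ℕ) : Type := (V d →L[ℂ] V d)ˣ

/-- The general linear group of `ℂ^(d+1)`. -/
abbrev GLW (d : ℕ) : Type := (W d →L[ℂ] W d)ˣ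

theorem mul_inv_apply {d : ℕ} (A : GLV d) (x : V d) :
    (A : V d →L[ℂ] V d) ((↑A⁻¹ : V d →L[ℂ] V d) x) = x := by
  rw [← mul_apply_eq_comp, Units.mul_inv, one_apply_eq_self]

theorem inv_mul_apply {d : ℕ} (A : GLV d) (x : V d) :
    (↑A⁻¹ : V d →L[ℂ] V d) ((A : V d →L[ℂ] V d) x) = x := by
  rw [← mul_apply_eq_comp, Units.inv_mul, one_apply_eq_self]

/-- The block matrix `!![c, b; x, A]` acting on `ℂ × ℂ^d`, i.e.
`(s, y) ↦ (c * s + b y, s • x + A y)`. -/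
def block {d : ℕ} (c : ℂ) (b : V d →L[ℂ] ℂ) (x : V d) (A : V d →L[ℂ] V d) : W d →L[ℂ] W d :=
  (((ContinuousLinearMap.id ℂ ℂ).smulRight c).coprod b).prod
    (((ContinuousLinearMap.id ℂ ℂ).smulRight x).coprod A)

@[simp]
theorem block_apply {d : ℕ} (c : ℂ) (b : V d →L[ℂ] ℂ) (x : V d) (A : V d →L[ℂ] V d) (w : W d) :
    block c b x A w = (w.1 * c + b w.2, w.1 • x + A w.2) := rfl

/-- The inclusion of the stabilizer of the origin, in the group of affine transformations of
`ℂ^d`, into `GL(d+1, ℂ)`: the affine map `y ↦ A y + x` is `!![1, 0; x, A]`. -/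
def affineRep (d : ℕ) : GLV d →* GLW d where
  toFun h := ⟨block 1 0 0 h, block 1 0 0 ↑h⁻¹, by
    ext w i <;> simp [mul_inv_apply], by ext w i <;> simp [inv_mul_apply]⟩
  map_one' := by ext <;> simp
  map_mul' h k := by ext <;> simp

/-- Conjugation by an invertible operator: the adjoint action of `GL(d+1, ℂ)`. -/
def conj (d : ℕ) : GLW d →* Module.End ℂ (W d →L[ℂ] W d) where
  toFun g :=
    { toFun := fun M => g * M * ↑g⁻¹
      map_add' := fun M N => by rw [mul_add, add_mul]
      map_smul' := fun c M => by
        refine ContinuousLinearMap.ext fun w => ?_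
        simp }
  map_one' := by
    refine LinearMap.ext fun M => ?_
    simp
  map_mul' g h := by
    refine LinearMap.ext fun M => ?_
    simp [mul_assoc]

theorem conj_apply {d : ℕ} (g : GLW d) (M : W d →L[ℂ] W d) : conj d g M = g * M * ↑g⁻¹ := rfl

/-- The Lie algebra of the affine group `ℂ^d ⋊ GL(d, ℂ)`: all operators `!![0, 0; x, A]`. -/
def affineLieAlg (d : ℕ) : Submodule ℂ (W d →L[ℂ] W d) where
  carrier := {M | ∀ w, (M w).1 = 0}
  add_mem' := by
    intro M N hM hN w
    simp [hM w, hN w]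
  zero_mem' := by simp
  smul_mem' := by
    intro c M hM w
    simp [hM w]

/-- The model `(ℂ^d ⋊ GL(d, ℂ)) / GL(d, ℂ)` of affine geometry. -/
def affineModel (d : ℕ) : KleinModel (V d →L[ℂ] V d) (GLV d) (W d) where
  lieAlg := affineLieAlg d
  lie_mem := by
    intro M hM N hN w
    simp [hM _, hN _]
  Ad := (conj d).comp (affineRep d)
  Ad_mem := by
    intro h M hM w
    simp [conj_apply, affineRep, hM _]
  incl :=
    { toFun := fun A => block 0 0 0 A
      map_add' := fun A B => by ext <;> simp
      map_smul' := fun c A => by ext <;> simp }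
  incl_mem := by
    intro A w
    simp

/-- A branched holomorphic affine structure on the `d`-dimensional complex manifold `X`. -/
abbrev BranchedAffineStructure (d : ℕ) (X : Type u) [TopologicalSpace X]
    [ChartedSpace (Fin d → ℂ) X] : Type (max u (v + 1)) :=
  BranchedCartanGeometry.{u, v} d X (affineModel d)

/-- The homomorphism from `ℂˣ` to `GL(d+1, ℂ)` whose image are the scalar operators. -/
def scalar (d : ℕ) : ℂˣ →* GLW d := Units.map (algebraMap ℂ (W d →L[ℂ] W d)).toMonoidHom

theorem scalar_apply {d : ℕ} (c : ℂˣ) (w : W d) :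
    (scalar d c : W d →L[ℂ] W d) w = (c : ℂ) • w := by
  simp [scalar, Algebra.algebraMap_eq_smul_one]

theorem scalar_comm {d : ℕ} (c : ℂˣ) (g : GLW d) : scalar d c * g = g * scalar d c := by
  refine Units.ext (ContinuousLinearMap.ext fun w => ?_)
  simp [scalar_apply]

/-- The subgroup of scalar operators, which is the center of `GL(d+1, ℂ)`. -/
def scalars (d : ℕ) : Subgroup (GLW d) := (scalar d).range

instance (d : ℕ) : (scalars d).Normal where
  conj_mem := by
    rintro _ ⟨c, rfl⟩ g
    exact ⟨c, by rw [← scalar_comm, mul_inv_cancel_right]⟩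

/-- The group `PGL(d+1, ℂ)`. -/
abbrev PGLW (d : ℕ) : Type := GLW d ⧸ scalars d

/-- The point `[1 : 0 : ⋯ : 0]` of `ℂP^d`. -/
def basePoint (d : ℕ) : ℙ ℂ (W d) := Projectivization.mk ℂ ((1, 0) : W d) (by simp)

/-- The maximal parabolic subgroup of `PGL(d+1, ℂ)` which fixes the point `[1 : 0 : ⋯ : 0]`. -/
def parabolic (d : ℕ) : Subgroup (PGLW d) :=
  (MulAction.stabilizer (GLW d) (basePoint d)).map (QuotientGroup.mk' (scalars d))

/-- The parabolic subgroup as a type. -/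
def Q (d : ℕ) : Type := parabolic d

instance (d : ℕ) : Group (Q d) := inferInstanceAs (Group (parabolic d))

/-- The invertible operator `!![1, b; 0, A]`. -/
def upper {d : ℕ} (b : V d →L[ℂ] ℂ) (A : GLV d) : GLW d :=
  ⟨block 1 b 0 A, block 1 (-(b.comp (↑A⁻¹ : V d →L[ℂ] V d))) 0 ↑A⁻¹, by
    ext w i <;> simp [mul_inv_apply], by
    ext w i <;> simp [inv_mul_apply]⟩

theorem upper_apply {d : ℕ} (b : V d →L[ℂ] ℂ) (A : GLV d) (w : W d) :
    (upper b A : W d →L[ℂ] W d) w = (w.1 + b w.2, (A : V d →L[ℂ] V d) w.2) := by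
  simp [upper]

theorem smul_basePoint_eq_iff {d : ℕ} (g : GLW d) :
    g • basePoint d = basePoint d ↔ ∃ c : ℂˣ, (g : W d →L[ℂ] W d) (1, 0) = (c : ℂ) • (1, 0) := by
  rw [basePoint, Projectivization.smul_mk, Projectivization.mk_eq_mk_iff]
  exact ⟨fun ⟨c, h⟩ => ⟨c, h.symm⟩, fun ⟨c, h⟩ => ⟨c, h.symm⟩⟩

theorem upper_mem {d : ℕ} (b : V d →L[ℂ] ℂ) (A : GLV d) :
    upper b A ∈ MulAction.stabilizer (GLW d) (basePoint d) := by
  rw [MulAction.mem_stabilizer_iff, smul_basePoint_eq_iff]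
  exact ⟨1, by simp [upper_apply]⟩

/-- An invertible operator which fixes `(1, 0)` is of the form `!![1, b; 0, A]`. -/
theorem exists_upper {d : ℕ} (g : GLW d) (hg : (g : W d →L[ℂ] W d) (1, 0) = (1, 0)) :
    ∃ b A, g = upper b A := by
  have hi : (↑g⁻¹ : W d →L[ℂ] W d) (1, 0) = (1, 0) := by
    conv_lhs => rw [← hg]
    rw [← mul_apply_eq_comp, Units.inv_mul, one_apply_eq_self]
  have key : ∀ k l : W d →L[ℂ] W d, k (1, 0) = (1, 0) → k * l = 1 → ∀ x : V d,
      (k (0, (l (0, x)).2)).2 = x := by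
    intro k l hk hkl x
    have h1 : ((0, (l (0, x)).2) : W d) = l (0, x) - (l (0, x)).1 • ((1, 0) : W d) := by
      ext <;> simp
    have h2 : k (l (0, x)) = (0, x) := by
      rw [← mul_apply_eq_comp, hkl, one_apply_eq_self]
    rw [h1, map_sub, map_smul, hk, h2]
    simp
  let r : (W d →L[ℂ] W d) → V d →L[ℂ] V d := fun k =>
    (ContinuousLinearMap.snd ℂ ℂ (V d)).comp (k.comp (ContinuousLinearMap.inr ℂ ℂ (V d)))
  refine ⟨(ContinuousLinearMap.fst ℂ ℂ (V d)).comp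
    ((g : W d →L[ℂ] W d).comp (ContinuousLinearMap.inr ℂ ℂ (V d))),
    ⟨r g, r ↑g⁻¹, ContinuousLinearMap.ext fun x => key _ _ hg (Units.mul_inv g) x,
      ContinuousLinearMap.ext fun x => key _ _ hi (Units.inv_mul g) x⟩, ?_⟩
  refine Units.ext (ContinuousLinearMap.ext fun w => ?_)
  have hw : w = w.1 • ((1, 0) : W d) + (0, w.2) := by ext <;> simp
  conv_lhs => rw [hw, map_add, map_smul, hg]
  rw [upper_apply]
  ext <;> simp [r]

/-- The class of `!![1, b; 0, A]` in the parabolic subgroup. -/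
def parabolicMk (d : ℕ) (y : (V d →L[ℂ] ℂ) × GLV d) : Q d :=
  (⟨QuotientGroup.mk' (scalars d) (upper y.1 y.2), upper y.1 y.2, upper_mem _ _, rfl⟩ :
    parabolic d)

theorem parabolicMk_bijective (d : ℕ) : Function.Bijective (parabolicMk d) := by
  constructor
  · rintro ⟨b, A⟩ ⟨b', A'⟩ h
    have h1 : QuotientGroup.mk' (scalars d) (upper b A) = QuotientGroup.mk' (scalars d) (upper b' A') :=
      congrArg Subtype.val h
    obtain ⟨_, ⟨c, rfl⟩, h2⟩ := (QuotientGroup.mk'_eq_mk' _).1 h1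
    have h3 : ∀ w : W d, ((c : ℂ) * w.1 + b ((c : ℂ) • w.2), (A : V d →L[ℂ] V d) ((c : ℂ) • w.2)) =
        (w.1 + b' w.2, (A' : V d →L[ℂ] V d) w.2) := by
      intro w
      rw [← upper_apply, ← h2]
      simp [scalar_apply, upper_apply, mul_add]
    have hc : (c : ℂ) = 1 := by simpa using congrArg Prod.fst (h3 (1, 0))
    simp only [hc, one_mul, one_smul, Prod.mk.injEq, add_right_inj] at h3
    refine Prod.ext ?_ (Units.ext ?_)
    · exact ContinuousLinearMap.ext fun x => (h3 (0, x)).1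
    · exact ContinuousLinearMap.ext fun x => (h3 (0, x)).2
  · rintro ⟨_, g, hg, rfl⟩
    obtain ⟨c, hc⟩ := (smul_basePoint_eq_iff g).1 hg
    have hg' : (↑(g * scalar d c⁻¹) : W d →L[ℂ] W d) (1, 0) = (1, 0) := by
      rw [Units.val_mul, mul_apply_eq_comp, scalar_apply, map_smul, hc, smul_smul,
        Units.inv_mul, one_smul]
    obtain ⟨b, A, h⟩ := exists_upper _ hg'
    have hmem : scalar d c⁻¹ ∈ scalars d := ⟨c⁻¹, rfl⟩
    refine ⟨(b, A), Subtype.ext ?_⟩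
    change QuotientGroup.mk' (scalars d) (upper b A) = QuotientGroup.mk' (scalars d) g
    exact ((QuotientGroup.mk'_eq_mk' _).2 ⟨_, hmem, h⟩).symm

/-- The coordinates `(b, A)` on the parabolic subgroup: every element of it is the class of
exactly one operator `!![1, b; 0, A]`. -/
def parabolicEquiv (d : ℕ) : ((V d →L[ℂ] ℂ) × GLV d) ≃ Q d :=
  Equiv.ofBijective (parabolicMk d) (parabolicMk_bijective d)

/-- The complex manifold structure of the parabolic subgroup: the coordinates `(b, A)` are a
global chart. -/
instance (d : ℕ) : TopologicalSpace (Q d) := .induced (parabolicEquiv d).symm inferInstance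

theorem isOpenEmbedding_coord (d : ℕ) : Topology.IsOpenEmbedding
    (fun q : Q d => ((((parabolicEquiv d).symm q).1, (((parabolicEquiv d).symm q).2 :
      V d →L[ℂ] V d)) : (V d →L[ℂ] ℂ) × (V d →L[ℂ] V d))) := by
  have h1 : Topology.IsOpenEmbedding (parabolicEquiv d).symm :=
    ⟨⟨⟨rfl⟩, (parabolicEquiv d).symm.injective⟩, by
      rw [(parabolicEquiv d).symm.surjective.range_eq]
      exact isOpen_univ⟩
  exact (Topology.IsOpenEmbedding.id.prodMap Units.isOpenEmbedding_val).comp h1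

instance (d : ℕ) : ChartedSpace ((V d →L[ℂ] ℂ) × (V d →L[ℂ] V d)) (Q d) :=
  (isOpenEmbedding_coord d).singletonChartedSpace

/-- The adjoint action of `PGL(d+1, ℂ)`: conjugation by any representative. -/
def projConj (d : ℕ) : PGLW d →* Module.End ℂ (W d →L[ℂ] W d) :=
  QuotientGroup.lift _ (conj d) <| by
    rintro _ ⟨c, rfl⟩
    refine LinearMap.ext fun M => ?_
    have h : (scalar d c : W d →L[ℂ] W d) * M = M * (scalar d c : W d →L[ℂ] W d) :=
      ContinuousLinearMap.ext fun w => by simp [scalar_apply]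
    rw [conj_apply, h, mul_assoc, Units.mul_inv, mul_one]
    rfl

theorem projConj_mk {d : ℕ} (g : GLW d) (M : W d →L[ℂ] W d) :
    projConj d (QuotientGroup.mk' (scalars d) g) M = g * M * ↑g⁻¹ := rfl

/-- The Lie algebra of `PGL(d+1, ℂ)`, i.e. `𝔤𝔩(d+1, ℂ) / ℂ`, realized as `𝔰𝔩(d+1, ℂ)`. -/
def projLieAlg (d : ℕ) : Submodule ℂ (W d →L[ℂ] W d) where
  carrier := {M | LinearMap.trace ℂ (W d) M = 0}
  add_mem' := by
    intro M N hM hN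
    simp_all
  zero_mem' := by simp
  smul_mem' := by
    intro c M hM
    simp_all

/-- The trace-free part of an operator, i.e. the projection of `𝔤𝔩(d+1, ℂ)` onto
`𝔤𝔩(d+1, ℂ) / ℂ = 𝔰𝔩(d+1, ℂ)`. -/
def traceFree (d : ℕ) : (W d →L[ℂ] W d) →ₗ[ℂ] (W d →L[ℂ] W d) where
  toFun M := M - (LinearMap.trace ℂ (W d) M / (d + 1)) • 1
  map_add' M N := by
    refine ContinuousLinearMap.ext fun w => ?_
    simp [add_div, add_smul]
    abel_nf
  map_smul' c M := by
    refine ContinuousLinearMap.ext fun w => ?_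
    simp [mul_div_assoc, mul_smul, smul_sub]

theorem trace_traceFree {d : ℕ} (M : W d →L[ℂ] W d) :
    LinearMap.trace ℂ (W d) (traceFree d M : W d →L[ℂ] W d) = 0 := by
  have h : (d : ℂ) + 1 ≠ 0 := Nat.cast_add_one_ne_zero d
  change LinearMap.trace ℂ (W d) ((M : W d →ₗ[ℂ] W d) -
    (LinearMap.trace ℂ (W d) M / (d + 1)) • (1 : W d →ₗ[ℂ] W d)) = 0
  rw [map_sub, map_smul, LinearMap.trace_one]
  simp only [Module.finrank_prod, Module.finrank_self, Module.finrank_fintype_fun_eq_card,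
    Fintype.card_fin, smul_eq_mul]
  push_cast
  field_simp
  ring

/-- The derivative at the identity of `(b, A) ↦ !![1, b; 0, A]`. -/
def upperDeriv (d : ℕ) : (V d →L[ℂ] ℂ) × (V d →L[ℂ] V d) →ₗ[ℂ] (W d →L[ℂ] W d) where
  toFun y := block 0 y.1 0 y.2
  map_add' y z := by ext <;> simp
  map_smul' c y := by ext <;> simp

/-- The model `PGL(d+1, ℂ) / Q` of projective geometry. -/
def projectiveModel (d : ℕ) : KleinModel ((V d →L[ℂ] ℂ) × (V d →L[ℂ] V d)) (Q d) (W d) where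
  lieAlg := projLieAlg d
  lie_mem := by
    intro M _ N _
    change LinearMap.trace ℂ (W d) ((M : W d →ₗ[ℂ] W d) * N - (N : W d →ₗ[ℂ] W d) * M) = 0
    rw [map_sub, LinearMap.trace_mul_comm, sub_self]
  Ad := (projConj d).comp (parabolic d).subtype
  Ad_mem := by
    rintro ⟨_, g, hg, rfl⟩ M hM
    change LinearMap.trace ℂ (W d) ((g : W d →L[ℂ] W d) * M * (↑g⁻¹ : W d →L[ℂ] W d) :
      W d →L[ℂ] W d) = 0
    change LinearMap.trace ℂ (W d) (((g : W d →L[ℂ] W d) : W d →ₗ[ℂ] W d) * (M : W d →ₗ[ℂ] W d) *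
      ((↑g⁻¹ : W d →L[ℂ] W d) : W d →ₗ[ℂ] W d)) = 0
    have h : ((↑g⁻¹ : W d →L[ℂ] W d) : W d →ₗ[ℂ] W d) * ((g : W d →L[ℂ] W d) : W d →ₗ[ℂ] W d) = 1 := by
      have := Units.inv_mul g
      exact congrArg ContinuousLinearMap.toLinearMap this
    rw [LinearMap.trace_mul_comm, ← mul_assoc, h, one_mul]
    exact hM
  incl := (traceFree d).comp (upperDeriv d)
  incl_mem := by
    intro y
    exact trace_traceFree _

/-- A branched holomorphic projective structure on the `d`-dimensional complex manifold `X`. -/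
abbrev BranchedProjectiveStructure (d : ℕ) (X : Type u) [TopologicalSpace X]
    [ChartedSpace (Fin d → ℂ) X] : Type (max u (v + 1)) :=
  BranchedCartanGeometry.{u, v} d X (projectiveModel d)

end

end BranchedCartan

/-! ### Cauchy's formula on polydiscs and Osgood's lemma -/

section Osgood

open Complex MeasureTheory Metric Set

variable {A : Type*} [NormedAddCommGroup A] [NormedSpace ℂ A]

/-! Flatness makes `β` locally the logarithmic derivative `f⁻¹ df` of an invertible operator-valued
function `f` on the total space (`exists_local_frame`, from the Frobenius theorem). For both models
the structure group has a representation `ρ` on `ℂ × ℂ^d` that induces the adjoint action and fixes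
`e = (1, 0)`. Morally `q ↦ f(q) e` is the developing map into `ℂ^d` or `ℂP^d`. It is never built
globally; its coordinates are read off from flat sections of the adjoint bundle, i.e.
operator-valued `φ` with `dφ = [φ, β]` and `φ(q h) = ρ(h)⁻¹ φ(q) ρ(h)`. Only commutators with `β`
enter, so the scalar ambiguity of `PGL` is harmless.

Locally such sections are conjugates `g⁻¹ a g` with `a` constant (`exists_isFlatSection_conj`).
Their gluing is a locally constant cocycle, so on a simply connected `X` there is one with any
prescribed value at a point (`exists_isFlatSection_univ`), and only one
(`IsFlatSection.eq_of_apply_eq`). Products of flat sections are flat, hence algebraic identities at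
one point hold everywhere.

Affine case: for a suitable initial value, the first coordinate of `φ e` is invariant under the
group and descends to a holomorphic function on `X`, morally a coordinate of the developing map.
Compactness makes it constant, but its derivative is nonzero at a point where `β` is an isomorphism.

Projective case: flat sections that start at `ξ ⊗ e` all take values in operators whose image is a
common moving line, so at `e` they have scalar ratios. These are the ratios of homogeneous
coordinates of the developing map, and they descend to meromorphic functions on `X`
(`isMeromorphic_of_flat_ratio`). Where `β` is an isomorphism the resulting map to `ℂ^d` is a
submersion, so no nonzero polynomial can vanish on its values.

Frobenius yields only complex differentiability; Osgood's lemma upgrades it to the analyticity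
needed for the identity theorem and for meromorphy. -/

theorem torusMap_sub_ne_zero {n : ℕ} {c z : Fin n → ℂ} {r : ℝ} (hz : z ∈ ball c r)
    (θ : Fin n → ℝ) (i : Fin n) : torusMap c (fun _ => r) θ i - z i ≠ 0 := by
  intro h
  have hr : 0 < r := dist_nonneg.trans_lt hz
  have h1 : z i - c i = r * exp (θ i * I) := by
    rw [← sub_eq_zero.1 h]
    simp [torusMap]
  have h2 : ‖z i - c i‖ < r := by
    rw [← dist_eq_norm]
    exact (dist_le_pi_dist z c i).trans_lt hz
  rw [h1, norm_mul, norm_exp_ofReal_mul_I, mul_one, norm_real, Real.norm_of_nonneg hr.le] at h2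
  exact h2.false

theorem torusMap_mem_closedBall {n : ℕ} (c : Fin n → ℂ) {r : ℝ} (hr : 0 ≤ r) (θ : Fin n → ℝ) :
    torusMap c (fun _ => r) θ ∈ closedBall c r := by
  rw [mem_closedBall, dist_pi_le_iff hr]
  intro i
  simp [torusMap, dist_eq_norm, norm_exp_ofReal_mul_I, abs_of_nonneg hr]

theorem continuous_torusMap {n : ℕ} (c : Fin n → ℂ) (R : Fin n → ℝ) :
    Continuous (torusMap c R) := by
  unfold torusMap
  fun_prop

theorem differentiableAt_cons_right {n : ℕ} (x : ℂ) (y : Fin n → ℂ) :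
    DifferentiableAt ℂ (fun y : Fin n → ℂ => (Fin.cons x y : Fin (n + 1) → ℂ)) y := by
  rw [differentiableAt_pi]
  refine Fin.cases ?_ fun i => ?_
  · simp
  · simpa only [Fin.cons_succ] using differentiableAt_apply i y

theorem differentiableAt_cons_left {n : ℕ} (x : ℂ) (y : Fin n → ℂ) :
    DifferentiableAt ℂ (fun x => (Fin.cons x y : Fin (n + 1) → ℂ)) x := by
  rw [differentiableAt_pi]
  refine Fin.cases ?_ fun i => ?_ <;> simp

/-- The Cauchy integral formula on a polydisc. -/
theorem torusIntegral_prod_sub_inv_smul [CompleteSpace A] {n : ℕ} {c z : Fin n → ℂ} {r : ℝ}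
    (hr : 0 < r) {f : (Fin n → ℂ) → A} (hf : ∀ ζ ∈ closedBall c r, DifferentiableAt ℂ f ζ)
    (hz : z ∈ ball c r) :
    (∯ ζ in T(c, fun _ => r), (∏ i, (ζ i - z i)⁻¹) • f ζ) = (2 * Real.pi * I : ℂ) ^ n • f z := by
  induction n with
  | zero =>
    rw [torusIntegral_dim0]
    simp [Subsingleton.elim c z]
  | succ n ih =>
    have hint : TorusIntegrable (fun ζ => (∏ i, (ζ i - z i)⁻¹) • f ζ) c (fun _ => r) := by
      refine ContinuousOn.integrableOn_compact isCompact_Icc (ContinuousOn.smul ?_ ?_)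
      · refine continuousOn_finsetProd _ fun i _ => ContinuousOn.inv₀ ?_
          fun θ _ => torusMap_sub_ne_zero hz θ i
        exact Continuous.continuousOn (((continuous_apply i).comp
          (continuous_torusMap c fun _ => r)).sub (continuous_const (y := z i)))
      · intro θ _
        exact ((hf _ (torusMap_mem_closedBall c hr.le θ)).continuousAt.comp
          (continuous_torusMap c _).continuousAt).continuousWithinAt
    have hcons : ∀ x ∈ closedBall (c 0) r, ∀ y ∈ closedBall (c ∘ Fin.succ) r,
        (Fin.cons x y : Fin (n + 1) → ℂ) ∈ closedBall c r := by
      intro x hx y hy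
      rw [mem_closedBall, dist_pi_le_iff hr.le] at hy ⊢
      refine Fin.cases ?_ ?_
      · simpa using hx
      · intro i
        simpa using hy i
    have hz0 : z 0 ∈ ball (c 0) r := (dist_le_pi_dist z c 0).trans_lt hz
    have hz1 : z ∘ Fin.succ ∈ ball (c ∘ Fin.succ) r := by
      rw [mem_ball, dist_pi_lt_iff hr] at hz ⊢
      exact fun i => hz i.succ
    have hinner : ∀ x ∈ sphere (c 0) r,
        (∯ y in T(c ∘ Fin.succ, (fun _ => r) ∘ Fin.succ),
          (∏ i, ((Fin.cons x y : Fin (n + 1) → ℂ) i - z i)⁻¹) • f (Fin.cons x y)) =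
        (x - z 0)⁻¹ • (2 * Real.pi * I : ℂ) ^ n • f (Fin.cons x (z ∘ Fin.succ)) := by
      intro x hx
      have := ih (c := c ∘ Fin.succ) (z := z ∘ Fin.succ) (f := fun y => f (Fin.cons x y))
        (fun y hy => DifferentiableAt.comp (g := f) y
          (hf _ (hcons x (sphere_subset_closedBall hx) y hy)) (differentiableAt_cons_right x y)) hz1
      rw [← this, ← torusIntegral_smul]
      congr 1
      ext y
      rw [Fin.prod_univ_succ, mul_smul]
      simp
    rw [torusIntegral_succ hint, circleIntegral.integral_congr hr.le hinner]
    have hd : ∀ x ∈ closedBall (c 0) r,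
        DifferentiableAt ℂ (fun x => f (Fin.cons x (z ∘ Fin.succ))) x := fun x hx =>
      DifferentiableAt.comp (g := f) x
        (hf _ (hcons x hx _ (ball_subset_closedBall hz1))) (differentiableAt_cons_left x _)
    have := Complex.circleIntegral_sub_inv_smul_of_differentiable_on_off_countable
      (countable_empty) hz0
      (f := fun x => (2 * Real.pi * I : ℂ) ^ n • f (Fin.cons x (z ∘ Fin.succ)))
      (fun x hx => ((hd x hx).continuousAt.const_smul _).continuousWithinAt)
      (fun x hx => (hd x (ball_subset_closedBall hx.1)).const_smul _)
    rw [this, smul_smul, pow_succ']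
    congr 2
    ext i
    refine Fin.cases ?_ ?_ i <;> simp

/-- Integration against a continuous density, as a continuous linear map. -/
theorem exists_clm_setIntegral_smul {X : Type*} [TopologicalSpace X] [MeasurableSpace X]
    [OpensMeasurableSpace X] [CompactSpace X] (μ : Measure X) [IsFiniteMeasure μ]
    [SecondCountableTopologyEither X A] (h : C(X, A)) :
    ∃ L : C(X, ℂ) →L[ℂ] A, ∀ g, L g = ∫ x, g x • h x ∂μ := by
  have hi : ∀ g : C(X, ℂ), Integrable (fun x => g x • h x) μ := by
    intro g
    refine Integrable.of_bound (C := ‖g‖ * ‖h‖)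
      ((g.continuous.smul h.continuous).aestronglyMeasurable) (.of_forall fun x => ?_)
    rw [norm_smul]
    gcongr
    · exact g.norm_coe_le_norm x
    · exact h.norm_coe_le_norm x
  refine ⟨LinearMap.mkContinuous
    { toFun := fun g => ∫ x, g x • h x ∂μ
      map_add' := fun g g' => by
        rw [← integral_add (hi g) (hi g')]
        simp [add_smul]
      map_smul' := fun a g => by
        rw [RingHom.id_apply, ← integral_smul]
        simp [mul_smul] } (‖h‖ * μ.real univ) fun g => ?_, fun g => rfl⟩
  have := norm_integral_le_of_norm_le_const (μ := μ) (f := fun x => g x • h x)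
    (C := ‖g‖ * ‖h‖) (.of_forall fun x => by
    rw [norm_smul]
    gcongr
    · exact g.norm_coe_le_norm x
    · exact h.norm_coe_le_norm x)
  refine this.trans (le_of_eq ?_)
  ring

/-- Cauchy's formula writes `f` near `c` as a fixed continuous linear map (integration over the
torus) applied to the Cauchy kernel, viewed as an element of the Banach algebra of continuous
functions on the parameter cube. Inversion in a Banach algebra is analytic at units, so the kernel
depends analytically on `z`, and no series has to be summed under the integral. -/
theorem analyticAt_of_eventually_differentiableAt_pi [CompleteSpace A] {n : ℕ}
    {c : Fin n → ℂ} {f : (Fin n → ℂ) → A} (hf : ∀ᶠ z in nhds c, DifferentiableAt ℂ f z) :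
    AnalyticAt ℂ f c := by
  obtain ⟨r, hr, hball⟩ := ((nhds_basis_closedBall (x := c)).eventually_iff).1 hf
  let K : Set (Fin n → ℝ) := Icc 0 fun _ => 2 * Real.pi
  have : CompactSpace K := isCompact_iff_compactSpace.1 isCompact_Icc
  let R : Fin n → ℝ := fun _ => r
  -- The Cauchy kernel. `Ring.inverse` is a true inverse only for `z` in the open polydisc, which is
  -- all that is used.
  let κ : (Fin n → ℂ) → C(K, ℂ) := fun z =>
    ∏ i, Ring.inverse ((⟨fun θ => torusMap c R θ.1 i,
      ((continuous_apply i).comp (continuous_torusMap c R)).comp continuous_subtype_val⟩ : C(K, ℂ))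
        - algebraMap ℂ C(K, ℂ) (z i))
  have hunit : ∀ z ∈ ball c r, ∀ i, IsUnit ((⟨fun θ => torusMap c R θ.1 i,
      ((continuous_apply i).comp (continuous_torusMap c R)).comp continuous_subtype_val⟩ : C(K, ℂ))
        - algebraMap ℂ C(K, ℂ) (z i)) := by
    intro z hz i
    rw [ContinuousMap.isUnit_iff_forall_ne_zero]
    intro θ
    exact torusMap_sub_ne_zero hz θ.1 i
  have hκ : ∀ z ∈ ball c r, ∀ θ, κ z θ = ∏ i, (torusMap c R θ.1 i - z i)⁻¹ := by
    intro z hz θ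
    simp only [κ, ContinuousMap.prod_apply]
    refine Finset.prod_congr rfl fun i _ => ?_
    refine eq_inv_of_mul_eq_one_left ?_
    have := congrArg (fun g : C(K, ℂ) => g θ) (Ring.inverse_mul_cancel _ (hunit z hz i))
    exact this
  have hκa : AnalyticAt ℂ κ c := by
    refine Finset.analyticAt_fun_prod _ fun i _ => ?_
    refine AnalyticAt.fun_comp (analyticAt_inverse (𝕜 := ℂ) (hunit c (mem_ball_self hr) i).unit) ?_
    refine analyticAt_const.sub ?_
    exact ((Algebra.linearMap ℂ C(K, ℂ)).toContinuousLinearMap.analyticAt _).comp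
      ((ContinuousLinearMap.proj (R := ℂ) (φ := fun _ : Fin n => ℂ) i).analyticAt c)
  -- The product is the Jacobian factor of the parametrization of the torus.
  let h : C(K, A) := ⟨fun θ => (∏ i, (r * exp (θ.1 i * I) * I : ℂ)) • f (torusMap c R θ.1), by
    refine Continuous.smul (continuous_finsetProd _ fun i _ =>
      (continuous_const.mul (continuous_exp.comp ((continuous_ofReal.comp
        ((continuous_apply i).comp continuous_subtype_val)).mul continuous_const))).mul
        continuous_const) ?_
    refine continuous_iff_continuousAt.2 fun θ => ?_
    exact ((hball (torusMap_mem_closedBall c hr.le θ.1)).continuousAt.comp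
      (continuous_torusMap c R).continuousAt).comp continuous_subtype_val.continuousAt⟩
  have : IsFiniteMeasure (Measure.comap ((↑) : K → Fin n → ℝ) volume) := by
    refine ⟨?_⟩
    rw [Measure.comap_apply _ Subtype.val_injective
      (fun s hs => measurableSet_Icc.subtype_image hs) _ MeasurableSet.univ, image_univ,
      Subtype.range_coe]
    exact measure_Icc_lt_top
  obtain ⟨L, hL⟩ := exists_clm_setIntegral_smul (Measure.comap ((↑) : K → Fin n → ℝ) volume) h
  have hfL : ∀ z ∈ ball c r, f z = ((2 * Real.pi * I : ℂ) ^ n)⁻¹ • L (κ z) := by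
    intro z hz
    have h0 : (2 * Real.pi * I : ℂ) ^ n ≠ 0 :=
      pow_ne_zero _ (by simp [Real.pi_ne_zero, I_ne_zero])
    rw [eq_inv_smul_iff₀ h0, ← torusIntegral_prod_sub_inv_smul hr (fun ζ hζ => hball hζ) hz, hL,
      torusIntegral, ← integral_subtype_comap measurableSet_Icc]
    refine integral_congr_ae (.of_forall fun θ => ?_)
    simp only [hκ z hz, h, ContinuousMap.coe_mk, smul_smul, R]
    rw [mul_comm]
  have hfe : (fun z => ((2 * Real.pi * I : ℂ) ^ n)⁻¹ • L (κ z)) =ᶠ[nhds c] f := by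
    filter_upwards [ball_mem_nhds c hr] with z hz using (hfL z hz).symm
  refine AnalyticAt.congr ?_ hfe
  exact analyticAt_const.smul ((L.analyticAt _).comp hκa)

/-- **Osgood's lemma**: a function of several complex variables which is complex differentiable
near a point is analytic at that point. -/
theorem analyticAt_of_eventually_differentiableAt [CompleteSpace A] {N : Type*}
    [NormedAddCommGroup N] [NormedSpace ℂ N] [FiniteDimensional ℂ N] {c : N} {f : N → A}
    (hf : ∀ᶠ z in nhds c, DifferentiableAt ℂ f z) : AnalyticAt ℂ f c := by
  let e : N ≃L[ℂ] (Fin (Module.finrank ℂ N) → ℂ) :=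
    ContinuousLinearEquiv.ofFinrankEq (by simp)
  have h : AnalyticAt ℂ (f ∘ e.symm) (e c) := by
    refine analyticAt_of_eventually_differentiableAt_pi ?_
    have hc : Filter.Tendsto e.symm (nhds (e c)) (nhds c) := by
      simpa using e.symm.continuous.tendsto (e c)
    filter_upwards [hc.eventually hf] with z hz
    exact hz.comp z e.symm.differentiableAt
  have h2 := h.comp (e.toContinuousLinearMap.analyticAt c)
  refine h2.congr (.of_forall fun z => ?_)
  simp

end Osgood

/-! ### Radial parallel transport and the Frobenius theorem -/

section Frobenius

open Metric Set

variable {N : Type*} [NormedAddCommGroup N] [NormedSpace ℂ N]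
  {A : Type*} [NormedRing A] [NormedAlgebra ℂ A]

/-- The radial initial value problem `g' = g * η(t y) y`, `g 0 = 1`. -/
theorem exists_radial_transport [CompleteSpace A] {η : N → N →L[ℂ] A} {R M : ℝ} (hM : 0 ≤ M)
    (hη : ContinuousOn η (ball 0 R)) (hb : ∀ y ∈ ball (0 : N) R, ‖η y‖ ≤ M) {y : N}
    (hy : y ∈ ball (0 : N) R) (hy2 : (‖(1 : A)‖ + 1) * (M * ‖y‖) ≤ 1) :
    ∃ g : ℝ → A, g 0 = 1 ∧
      ∀ t ∈ Icc (0 : ℝ) 1, HasDerivWithinAt g (g t * η (t • y) y) (Icc 0 1) t := by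
  have hty : ∀ t ∈ Icc (0 : ℝ) 1, t • y ∈ ball (0 : N) R := by
    intro t ht
    rw [mem_ball_zero_iff] at hy ⊢
    rw [norm_smul, Real.norm_of_nonneg ht.1]
    exact (mul_le_of_le_one_left (norm_nonneg _) ht.2).trans_lt hy
  have hle : ∀ t ∈ Icc (0 : ℝ) 1, ‖η (t • y) y‖ ≤ M * ‖y‖ := fun t ht =>
    (η (t • y)).le_of_opNorm_le (hb _ (hty t ht)) y
  have hMy : 0 ≤ M * ‖y‖ := by positivity
  -- The solution is kept in the ball of radius `1` around `1`, where `‖x‖ ≤ ‖1‖ + 1`; the smallness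
  -- assumption then bounds the vector field by `1`, exactly enough to survive for unit time.
  have hPL : IsPicardLindelof (fun t x => x * η (t • y) y) (tmin := 0) (tmax := 1)
      ⟨0, by simp⟩ (1 : A) 1 0 1 ⟨M * ‖y‖, hMy⟩ := by
    refine ⟨?_, ?_, ?_, by simp⟩
    · intro t ht
      refine LipschitzWith.lipschitzOnWith (LipschitzWith.of_dist_le_mul fun x x' => ?_)
      rw [dist_eq_norm, dist_eq_norm, ← sub_mul, mul_comm _ ‖x - x'‖]
      exact (norm_mul_le _ _).trans (mul_le_mul_of_nonneg_left (hle t ht) (norm_nonneg _))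
    · intro x _
      refine continuousOn_const.mul (ContinuousOn.clm_apply (hη.comp ?_ fun t ht => hty t ht)
        continuousOn_const)
      fun_prop
    · intro t ht x hx
      have hx' : ‖x‖ ≤ ‖(1 : A)‖ + 1 := by
        have := norm_sub_norm_le x 1
        rw [mem_closedBall, dist_eq_norm] at hx
        simp at hx
        linarith
      refine (norm_mul_le _ _).trans (le_trans ?_ hy2)
      exact mul_le_mul hx' (hle t ht) (norm_nonneg _) (by positivity)
  exact hPL.exists_eq_forall_mem_Icc_hasDerivWithinAt₀

/-- Gronwall's inequality on the unit interval, with Lipschitz constant one. -/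
theorem norm_le_of_norm_deriv_le_norm_add {B : Type*} [NormedAddCommGroup B] [NormedSpace ℝ B]
    {f f' : ℝ → B} {ε : ℝ} (hε : 0 ≤ ε)
    (hf : ∀ t ∈ Icc (0 : ℝ) 1, HasDerivWithinAt f (f' t) (Icc 0 1) t) (h0 : f 0 = 0)
    (hb : ∀ t ∈ Icc (0 : ℝ) 1, ‖f' t‖ ≤ ‖f t‖ + ε) : ∀ t ∈ Icc (0 : ℝ) 1, ‖f t‖ ≤ 2 * ε := by
  intro t ht
  have := norm_le_gronwallBound_of_norm_deriv_right_le (f := f) (f' := f') (δ := 0) (K := 1)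
    (ε := ε) (fun t ht => (hf t ht).continuousWithinAt)
    (fun t ht => (hf t ⟨ht.1, ht.2.le⟩).mono_of_mem_nhdsWithin (Icc_mem_nhdsGE_of_mem ht))
    (by simp [h0]) (fun t ht => by simpa using hb t ⟨ht.1, ht.2.le⟩) t ht
  refine this.trans ?_
  rw [gronwallBound_of_K_ne_0 one_ne_zero]
  -- Gronwall gives the factor `e - 1`, which is at most `2`.
  have h1 : Real.exp (1 * (t - 0)) ≤ Real.exp 1 := Real.exp_le_exp.2 (by simpa using ht.2)
  have h2 := Real.exp_one_lt_d9
  simp only [div_one, zero_mul, zero_add]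
  nlinarith

/-- Gronwall for `g - 1` gives `‖g - 1‖ ≤ 2 ‖1‖`. The norm of `1` is kept, since it need not be one.
-/
theorem norm_le_three_mul_of_transport {g a : ℝ → A}
    (hg : ∀ t ∈ Icc (0 : ℝ) 1, HasDerivWithinAt g (g t * a t) (Icc 0 1) t) (h0 : g 0 = 1)
    (ha : ∀ t ∈ Icc (0 : ℝ) 1, ‖a t‖ ≤ 1) : ∀ t ∈ Icc (0 : ℝ) 1, ‖g t‖ ≤ 3 * ‖(1 : A)‖ := by
  intro t ht
  have h1 := norm_le_of_norm_deriv_le_norm_add (f := fun t => g t - 1) (norm_nonneg (1 : A))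
    (fun t ht => (hg t ht).sub_const 1) (by simp [h0])
    (fun t ht => by
      have : g t * a t = (g t - 1) * a t + 1 * a t := by noncomm_ring
      rw [this]
      refine (norm_add_le _ _).trans (add_le_add ?_ ?_)
      · exact (norm_mul_le _ _).trans (mul_le_of_le_one_right (norm_nonneg _) (ha t ht))
      · exact (norm_mul_le _ _).trans (mul_le_of_le_one_right (norm_nonneg _) (ha t ht))) t ht
  have h2 := norm_sub_norm_le (g t) 1
  linarith

/-- The key estimate of the Frobenius theorem: for a flat form the radial transport is
differentiable in the end point. -/
theorem norm_transport_sub_le {η : N → N →L[ℂ] A} {η' : N → N →L[ℂ] N →L[ℂ] A} {R M : ℝ}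
    (hM : 0 ≤ M) (hd : ∀ y ∈ ball (0 : N) R, HasFDerivAt η (η' y) y)
    (hb : ∀ y ∈ ball (0 : N) R, ‖η y‖ ≤ M) (hb' : ∀ y ∈ ball (0 : N) R, ‖η' y‖ ≤ M)
    (hl : ∀ y ∈ ball (0 : N) R, ∀ z ∈ ball (0 : N) R, ‖η' z - η' y‖ ≤ M * ‖z - y‖)
    (hflat : ∀ y ∈ ball (0 : N) R, ∀ v w,
      η' y v w - η' y w v + (η y v * η y w - η y w * η y v) = 0)
    (hR : R ≤ 1) (hMR : M * R ≤ 1)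
    {y h : N} (hy : y ∈ ball (0 : N) R) (hyh : y + h ∈ ball (0 : N) R) {g k : ℝ → A}
    (hg : ∀ t ∈ Icc (0 : ℝ) 1, HasDerivWithinAt g (g t * η (t • y) y) (Icc 0 1) t)
    (hk : ∀ t ∈ Icc (0 : ℝ) 1,
      HasDerivWithinAt k (k t * η (t • (y + h)) (y + h)) (Icc 0 1) t)
    (hg0 : g 0 = 1) (hk0 : k 0 = 1) :
    ‖k 1 - g 1 - g 1 * η y h‖ ≤ 2 * (6 * ‖(1 : A)‖ * (2 * M) ^ 2 + 3 * ‖(1 : A)‖ * (2 * M)) * ‖h‖ ^ 2 := by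
  have hmem : ∀ z ∈ ball (0 : N) R, ∀ t ∈ Icc (0 : ℝ) 1, t • z ∈ ball (0 : N) R := by
    intro z hz t ht
    rw [mem_ball_zero_iff] at hz ⊢
    rw [norm_smul, Real.norm_of_nonneg ht.1]
    exact (mul_le_of_le_one_left (norm_nonneg _) ht.2).trans_lt hz
  have hle : ∀ z ∈ ball (0 : N) R, ∀ t ∈ Icc (0 : ℝ) 1, ‖η (t • z) z‖ ≤ 1 := by
    intro z hz t ht
    refine ((η (t • z)).le_of_opNorm_le (hb _ (hmem z hz t ht)) z).trans (le_trans ?_ hMR)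
    exact mul_le_mul_of_nonneg_left (mem_ball_zero_iff.1 hz).le hM
  have hy1 : ‖y‖ ≤ 1 := (mem_ball_zero_iff.1 hy).le.trans hR
  -- differences of `η`
  have hdiff : ∀ t ∈ Icc (0 : ℝ) 1, ‖η (t • (y + h)) - η (t • y)‖ ≤ M * ‖h‖ := by
    intro t ht
    have := (convex_ball (0 : N) R).norm_image_sub_le_of_norm_hasFDerivWithin_le
      (fun z hz => (hd z hz).hasFDerivWithinAt) hb' (hmem y hy t ht) (hmem _ hyh t ht)
    refine this.trans (mul_le_mul_of_nonneg_left ?_ hM)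
    rw [← smul_sub, add_sub_cancel_left, norm_smul, Real.norm_of_nonneg ht.1]
    exact mul_le_of_le_one_left (norm_nonneg _) ht.2
  have hquad : ∀ t ∈ Icc (0 : ℝ) 1,
      ‖η (t • (y + h)) - η (t • y) - η' (t • y) (t • h)‖ ≤ M * ‖h‖ * ‖h‖ := by
    intro t ht
    have hsub : t • (y + h) - t • y = t • h := by rw [smul_add, add_sub_cancel_left]
    have hth : ‖t • h‖ ≤ ‖h‖ := by
      rw [norm_smul, Real.norm_of_nonneg ht.1]
      exact mul_le_of_le_one_left (norm_nonneg _) ht.2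
    have hseg : segment ℝ (t • y) (t • (y + h)) ⊆ ball (0 : N) R :=
      (convex_ball (0 : N) R).segment_subset (hmem y hy t ht) (hmem _ hyh t ht)
    have := (convex_segment (𝕜 := ℝ) (t • y) (t • (y + h))).norm_image_sub_le_of_norm_hasFDerivWithin_le'
      (f := η) (f' := η') (φ := η' (t • y)) (C := M * ‖h‖)
      (fun z hz => (hd z (hseg hz)).hasFDerivWithinAt)
      (fun z hz => (hl _ (hmem y hy t ht) z (hseg hz)).trans (mul_le_mul_of_nonneg_left
        ((norm_sub_le_of_mem_segment hz).trans (by rw [hsub]; exact hth)) hM))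
      (left_mem_segment ℝ _ _) (right_mem_segment ℝ _ _)
    rw [hsub] at this
    exact this.trans (mul_le_mul_of_nonneg_left hth (by positivity))
  have hΔ : ∀ t ∈ Icc (0 : ℝ) 1, ‖η (t • (y + h)) (y + h) - η (t • y) y‖ ≤ 2 * M * ‖h‖ := by
    intro t ht
    have e : η (t • (y + h)) (y + h) - η (t • y) y =
        (η (t • (y + h)) - η (t • y)) y + η (t • (y + h)) h := by
      simp only [map_add, sub_apply]
      abel
    rw [e]
    have h1 := ((η (t • (y + h)) - η (t • y)).le_of_opNorm_le (hdiff t ht) y)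
    have h2 := (η (t • (y + h))).le_of_opNorm_le (hb _ (hmem _ hyh t ht)) h
    have h3 : M * ‖h‖ * ‖y‖ ≤ M * ‖h‖ := mul_le_of_le_one_right (by positivity) hy1
    linarith [norm_add_le ((η (t • (y + h)) - η (t • y)) y) (η (t • (y + h)) h)]
  have hgn := norm_le_three_mul_of_transport hg hg0 (hle y hy)
  have hkn := norm_le_three_mul_of_transport hk hk0 (hle _ hyh)
  have hone : 0 ≤ ‖(1 : A)‖ := norm_nonneg _
  -- First order bound: `k - g` satisfies the transport equation of `g` up to an error linear in
  -- `h`.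
  have step1 := norm_le_of_norm_deriv_le_norm_add (f := fun t => k t - g t)
    (ε := 3 * ‖(1 : A)‖ * (2 * M * ‖h‖)) (by positivity)
    (fun t ht => (hk t ht).sub (hg t ht)) (by simp [hk0, hg0])
    (fun t ht => by
      have e : k t * η (t • (y + h)) (y + h) - g t * η (t • y) y =
          (k t - g t) * η (t • y) y + k t * (η (t • (y + h)) (y + h) - η (t • y) y) := by
        noncomm_ring
      rw [e]
      refine (norm_add_le _ _).trans (add_le_add ?_ ?_)
      · exact (norm_mul_le _ _).trans (mul_le_of_le_one_right (norm_nonneg _) (hle y hy t ht))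
      · exact (norm_mul_le _ _).trans
          (mul_le_mul (hkn t ht) (hΔ t ht) (norm_nonneg _) (by positivity)))
  have hηt : ∀ t ∈ Icc (0 : ℝ) 1,
      HasDerivWithinAt (fun t : ℝ => η (t • y) h) (η' (t • y) y h) (Icc 0 1) t := by
    intro t ht
    have h1 : HasDerivAt (fun t : ℝ => t • y) y t := by
      simpa using (hasDerivAt_id t).smul_const y
    have h2 : HasDerivAt (fun t : ℝ => η (t • y)) (η' (t • y) y) t := by
      have h0 := (hd _ (hmem y hy t ht)).restrictScalars ℝ
      exact h0.comp_hasDerivAt t h1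
    exact (((ContinuousLinearMap.apply ℂ A h).restrictScalars ℝ).hasFDerivAt.comp_hasDerivAt t
      h2).hasDerivWithinAt
  -- At time one this function is the remainder to be estimated. Flatness exchanges the arguments of
  -- `η'` at the price of a commutator; with it all terms linear in `h` cancel, and the function
  -- satisfies the transport equation of `g` up to an error quadratic in `h`.
  have step2 := norm_le_of_norm_deriv_le_norm_add
    (f := fun t => k t - g t - t • (g t * η (t • y) h))
    (ε := (6 * ‖(1 : A)‖ * (2 * M) ^ 2 + 3 * ‖(1 : A)‖ * (2 * M)) * ‖h‖ ^ 2) (by positivity)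
    (fun t ht => ((hk t ht).sub (hg t ht)).sub
      ((hasDerivWithinAt_id t _).smul ((hg t ht).mul (hηt t ht)))) (by simp [hk0, hg0])
    (fun t ht => by
      have hf : η' (t • y) y h = η' (t • y) h y + η (t • y) h * η (t • y) y
          - η (t • y) y * η (t • y) h := by
        rw [← sub_eq_zero, ← hflat _ (hmem y hy t ht) y h]
        abel
      have e : k t * η (t • (y + h)) (y + h) - g t * η (t • y) y -
          (t • (g t * η (t • y) y * η (t • y) h + g t * η' (t • y) y h)
            + (1 : ℝ) • (g t * η (t • y) h)) =
          (k t - g t - t • (g t * η (t • y) h)) * η (t • y) y +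
          ((k t - g t) * (η (t • (y + h)) (y + h) - η (t • y) y) +
            g t * ((η (t • (y + h)) - η (t • y) - η' (t • y) (t • h)) y +
              (η (t • (y + h)) - η (t • y)) h)) := by
        have hs : η' (t • y) (t • h) = t • η' (t • y) h :=
          ((η' (t • y)).restrictScalars ℝ).map_smul t h
        rw [hf, hs]
        simp only [map_add, sub_apply, smul_apply, mul_sub, mul_add, sub_mul, smul_add, smul_sub,
          smul_mul_assoc, mul_smul_comm, one_smul, mul_assoc]
        abel
      simp only [id_eq]
      rw [e]
      refine (norm_add_le _ _).trans (add_le_add ?_ ?_)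
      · exact (norm_mul_le _ _).trans (mul_le_of_le_one_right (norm_nonneg _) (hle y hy t ht))
      · refine (norm_add_le _ _).trans ?_
        rw [add_mul]
        refine add_le_add ?_ ?_
        · refine (norm_mul_le _ _).trans ((mul_le_mul (step1 t ht) (hΔ t ht) (norm_nonneg _)
            (by positivity)).trans (le_of_eq ?_))
          ring
        · refine (norm_mul_le _ _).trans ?_
          have h1 := (η (t • (y + h)) - η (t • y) - η' (t • y) (t • h)).le_of_opNorm_le
            (hquad t ht) y
          have h2 := (η (t • (y + h)) - η (t • y)).le_of_opNorm_le (hdiff t ht) h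
          have h3 : M * ‖h‖ * ‖h‖ * ‖y‖ ≤ M * ‖h‖ * ‖h‖ :=
            mul_le_of_le_one_right (by positivity) hy1
          refine (mul_le_mul (hgn t ht) ((norm_add_le _ _).trans
            (show _ ≤ 2 * M * ‖h‖ ^ 2 by nlinarith)) (norm_nonneg _) (by positivity)).trans
            (le_of_eq ?_)
          ring)
    1 (by simp)
  simp only [one_smul] at step2
  refine step2.trans (le_of_eq ?_)
  ring

/-- **Frobenius theorem** for a flat algebra-valued one-form `η`: near every point there is a
solution of `dF = F η`. -/
theorem exists_eventually_hasFDerivAt_mul_zero [CompleteSpace A] {η : N → N →L[ℂ] A} (hη : ContDiffAt ℂ 2 η 0)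
    (hflat : ∀ᶠ y in nhds (0 : N), ∀ v w,
      fderiv ℂ η y v w - fderiv ℂ η y w v + (η y v * η y w - η y w * η y v) = 0) :
    ∃ F : N → A, F 0 = 1 ∧
      ∀ᶠ y in nhds (0 : N), HasFDerivAt F ((ContinuousLinearMap.mul ℂ A (F y)).comp (η y)) y := by
  have hη' : ContDiffAt ℂ 1 (fderiv ℂ η) 0 := hη.fderiv_right (by norm_num)
  obtain ⟨K, s, hs, hK⟩ := hη'.exists_lipschitzOnWith
  have hd : ∀ᶠ y in nhds (0 : N), HasFDerivAt η (fderiv ℂ η y) y :=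
    (hη.eventually (by simp)).mono fun y hy => (hy.differentiableAt (by simp)).hasFDerivAt
  have hb : ∀ᶠ y in nhds (0 : N), ‖η y‖ < ‖η 0‖ + 1 :=
    hη.continuousAt.norm.eventually_lt continuousAt_const (by simp)
  have hb' : ∀ᶠ y in nhds (0 : N), ‖fderiv ℂ η y‖ < ‖fderiv ℂ η 0‖ + 1 := by
    have hc : ContinuousAt (fun y => ‖fderiv ℂ η y‖) 0 :=
      ContinuousAt.norm (E := N →L[ℂ] N →L[ℂ] A) hη'.continuousAt
    exact hc.eventually_lt continuousAt_const (lt_add_one _)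
  obtain ⟨r, hr, hball⟩ := Metric.eventually_nhds_iff_ball.1
    ((hflat.and hd).and ((hb.and hb').and (Filter.eventually_of_mem hs fun y hy => hy)))
  -- One constant that dominates `η`, its derivative and the Lipschitz constant of the derivative.
  let M : ℝ := ‖η 0‖ + 1 + (‖fderiv ℂ η 0‖ + 1) + K
  have h1 : 0 ≤ ‖η 0‖ := norm_nonneg _
  have h2 : 0 ≤ ‖fderiv ℂ η 0‖ := norm_nonneg (fderiv ℂ η 0)
  have h3 : (0 : ℝ) ≤ K := K.2
  have h4 : 0 ≤ ‖(1 : A)‖ := norm_nonneg _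
  have hM : 0 < M := by positivity
  -- The three bounds serve the validity of the local estimates, the condition `R ≤ 1` of the key
  -- estimate, and the Picard-Lindelöf condition.
  let R : ℝ := min r (min 1 (((‖(1 : A)‖ + 1) * M)⁻¹))
  have hR0 : 0 < R := by positivity
  have hR1 : R ≤ 1 := (min_le_right _ _).trans (min_le_left _ _)
  have hRr : ball (0 : N) R ⊆ ball 0 r := ball_subset_ball (min_le_left _ _)
  have hRM : (‖(1 : A)‖ + 1) * (M * R) ≤ 1 := by
    have : R ≤ ((‖(1 : A)‖ + 1) * M)⁻¹ := (min_le_right _ _).trans (min_le_right _ _)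
    rw [← mul_assoc]
    exact (mul_le_mul_of_nonneg_left this (by positivity)).trans
      (mul_inv_cancel₀ (by positivity)).le
  have hMR : M * R ≤ 1 := by nlinarith [mul_nonneg h4 (mul_pos hM hR0).le]
  have kd : ∀ y ∈ ball (0 : N) R, HasFDerivAt η (fderiv ℂ η y) y := fun y hy =>
    (hball y (hRr hy)).1.2
  have kb : ∀ y ∈ ball (0 : N) R, ‖η y‖ ≤ M := fun y hy =>
    (hball y (hRr hy)).2.1.1.le.trans (by simp only [M]; linarith)
  have kb' : ∀ y ∈ ball (0 : N) R, ‖fderiv ℂ η y‖ ≤ M := fun y hy =>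
    (hball y (hRr hy)).2.1.2.le.trans (by simp only [M]; linarith)
  have kl : ∀ y ∈ ball (0 : N) R, ∀ z ∈ ball (0 : N) R,
      ‖fderiv ℂ η z - fderiv ℂ η y‖ ≤ M * ‖z - y‖ := fun y hy z hz =>
    (hK.norm_sub_le (hball z (hRr hz)).2.2 (hball y (hRr hy)).2.2).trans
      (mul_le_mul_of_nonneg_right (by simp only [M]; linarith) (norm_nonneg _))
  have hex : ∀ y : N, ∃ g : ℝ → A, y ∈ ball (0 : N) R → g 0 = 1 ∧
      ∀ t ∈ Icc (0 : ℝ) 1, HasDerivWithinAt g (g t * η (t • y) y) (Icc 0 1) t := by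
    intro y
    by_cases hy : y ∈ ball (0 : N) R
    · obtain ⟨g, hg⟩ := exists_radial_transport hM.le
        (fun y hy => (kd y hy).continuousAt.continuousWithinAt) kb hy
        (le_trans (by gcongr; exact (mem_ball_zero_iff.1 hy).le) hRM)
      exact ⟨g, fun _ => hg⟩
    · exact ⟨0, fun h => (hy h).elim⟩
  choose g hg using hex
  refine ⟨fun y => g y 1, ?_, ?_⟩
  · have h0 := hg 0 (mem_ball_self hR0)
    have := norm_le_of_norm_deriv_le_norm_add (f := fun t => g 0 t - 1)
      (f' := fun t => g 0 t * η (t • 0) 0) le_rfl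
      (fun t ht => (h0.2 t ht).sub_const 1) (by simp [h0.1]) (fun t ht => by
        rw [map_zero, mul_zero, norm_zero]; positivity) 1 (by simp)
    simpa [sub_eq_zero] using this
  · filter_upwards [ball_mem_nhds (0 : N) hR0] with y hy
    refine HasFDerivAt.of_isLittleO ?_
    -- The remainder is quadratic directly from the key estimate, so smooth dependence of
    -- differential equations on parameters is not needed.
    have hO : (fun z => g z 1 - g y 1 - (ContinuousLinearMap.mul ℂ A (g y 1)).comp (η y) (z - y))
        =O[nhds y] fun z => ‖z - y‖ ^ 2 := by
      refine Asymptotics.IsBigO.of_bound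
        (2 * (6 * ‖(1 : A)‖ * (2 * M) ^ 2 + 3 * ‖(1 : A)‖ * (2 * M))) ?_
      filter_upwards [isOpen_ball.mem_nhds hy] with z hz
      have hz' : y + (z - y) ∈ ball (0 : N) R := by rwa [add_sub_cancel]
      have := norm_transport_sub_le hM.le kd kb kb' kl (fun w hw => (hball w (hRr hw)).1.1) hR1 hMR
        hy hz' (hg y hy).2 (hg _ hz').2 (hg y hy).1 (hg _ hz').1
      rw [add_sub_cancel] at this
      simpa using this
    refine hO.trans_isLittleO ?_
    have ht : Filter.Tendsto (fun z => z - y) (nhds y) (nhds 0) := by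
      have : ContinuousAt (fun z => z - y) y := by fun_prop
      simpa [ContinuousAt] using this
    have := (Asymptotics.isLittleO_norm_pow_id (E' := N) one_lt_two).comp_tendsto ht
    simpa [Function.comp_def] using this

/-- The Frobenius theorem, at an arbitrary center. -/
theorem exists_eventually_hasFDerivAt_mul [CompleteSpace A] {η : N → N →L[ℂ] A} {c : N} (hη : ContDiffAt ℂ 2 η c)
    (hflat : ∀ᶠ y in nhds c, ∀ v w,
      fderiv ℂ η y v w - fderiv ℂ η y w v + (η y v * η y w - η y w * η y v) = 0) :
    ∃ F : N → A, F c = 1 ∧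
      ∀ᶠ y in nhds c, HasFDerivAt F ((ContinuousLinearMap.mul ℂ A (F y)).comp (η y)) y := by
  have ht : Filter.Tendsto (fun y => c + y) (nhds 0) (nhds c) := by
    have : ContinuousAt (fun y => c + y) 0 := by fun_prop
    simpa [ContinuousAt] using this
  have ht' : Filter.Tendsto (fun y => y - c) (nhds c) (nhds 0) := by
    have : ContinuousAt (fun y => y - c) c := by fun_prop
    simpa [ContinuousAt] using this
  obtain ⟨F, hF0, hF⟩ := exists_eventually_hasFDerivAt_mul_zero (η := fun y => η (c + y))
    (ContDiffAt.comp (0 : N) (by simpa using hη) (contDiffAt_const.add contDiffAt_id))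
    ((ht.eventually hflat).mono fun y hy v w => by
      rw [fderiv_comp_add_left]
      exact hy v w)
  refine ⟨fun y => F (y - c), by simpa using hF0, ?_⟩
  filter_upwards [ht'.eventually hF] with y hy
  have := hy.comp y ((hasFDerivAt_id y).sub_const c)
  simpa [Function.comp_def] using this

end Frobenius

/-! ### Trivial monodromy over simply connected spaces -/

section Monodromy

open Set Filter

/-- On a simply connected, locally path connected space, a locally constant cocycle has global
sections with prescribed values. -/
theorem exists_section_of_locallyConstant_cocycle {X : Type*} [TopologicalSpace X]
    [SimplyConnectedSpace X] [LocallyPathConnectedSpace X] {ι 𝔽 : Type*} (U : ι → Set X)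
    (hU : ∀ i, IsOpen (U i)) (i₀ : X → ι) (hi₀ : ∀ x, x ∈ U (i₀ x)) (c : ι → ι → X → 𝔽 → 𝔽)
    (c_self : ∀ i, ∀ x ∈ U i, ∀ a, c i i x a = a)
    (c_comp : ∀ i j k, ∀ x ∈ U i ∩ U j ∩ U k, ∀ a, c j k x (c i j x a) = c i k x a)
    (c_const : ∀ i j, ∀ x ∈ U i ∩ U j, ∀ a, ∀ᶠ y in nhds x, c i j y a = c i j x a)
    (x₀ : X) (a₀ : 𝔽) :
    ∃ b : X → 𝔽, b x₀ = a₀ ∧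
      ∀ i, ∀ x ∈ U i, ∀ᶠ y in nhds x, c (i₀ y) i y (b y) = c (i₀ x) i x (b x) := by
  -- With a discrete fiber, local constancy of the cocycle is continuity of the coordinate changes,
  -- and the bundle it defines is a covering. Lifting the identity of `X` through it gives the
  -- section.
  let _ : TopologicalSpace 𝔽 := ⊥
  have : DiscreteTopology 𝔽 := ⟨rfl⟩
  let Z : FiberBundleCore ι X 𝔽 :=
    { baseSet := U
      isOpen_baseSet := hU
      indexAt := i₀
      mem_baseSet_at := hi₀
      coordChange := c
      coordChange_self := c_self
      continuousOn_coordChange := by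
        rintro i j ⟨x, a⟩ ⟨hx, -⟩
        refine ContinuousAt.continuousWithinAt ?_
        rw [ContinuousAt, nhds_discrete 𝔽, nhds_prod_eq, nhds_discrete 𝔽, tendsto_pure,
          prod_pure, eventually_map]
        exact c_const i j x hx a
      coordChange_comp := c_comp }
  have hcov : IsCoveringMap (Bundle.TotalSpace.proj : Bundle.TotalSpace 𝔽 Z.Fiber → X) :=
    FiberBundle.isCoveringMap
  obtain ⟨f, ⟨hf0, hf⟩, -⟩ := hcov.existsUnique_continuousMap_lifts (ContinuousMap.id X) x₀
    (⟨x₀, a₀⟩ : Bundle.TotalSpace 𝔽 Z.Fiber) rfl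
  have hf' : ∀ x, (f x).1 = x := fun x => congrFun hf x
  refine ⟨fun x => (f x).2, ?_, fun i x hx => ?_⟩
  · change (f x₀).2 = a₀
    rw [hf0]
  · have hc : ContinuousAt (fun y => (Z.localTriv i (f y)).2) x := by
      refine continuousAt_snd.comp (ContinuousAt.comp ?_ f.continuous.continuousAt)
      refine (Z.localTriv i).continuousAt ?_
      rw [(Z.localTriv i).mem_source]
      change (f x).1 ∈ U i
      rwa [hf']
    rw [ContinuousAt, nhds_discrete 𝔽, tendsto_pure] at hc
    filter_upwards [hc] with y hy
    rw [FiberBundleCore.localTriv_apply, FiberBundleCore.localTriv_apply] at hy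
    simpa only [hf'] using hy

end Monodromy

/-! ### The form in charts and local frames -/

namespace BranchedCartan

open Set Filter

/-- Lets derivatives be compared vector by vector, so that tangent spaces are matched with model
spaces by unfolding rather than by rewriting. -/
theorem hasMFDerivAt_of_apply_eq {N G M B : Type*} [NormedAddCommGroup N] [NormedSpace ℂ N]
    [TopologicalSpace G] {I : ModelWithCorners ℂ N G} [TopologicalSpace M] [ChartedSpace G M]
    [NormedAddCommGroup B] [NormedSpace ℂ B] {f : M → B} {p : M}
    {L L' : TangentSpace I p →L[ℂ] B} (h : HasMFDerivAt I 𝓘(ℂ, B) f p L) (hL : ∀ v, L v = L' v) :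
    HasMFDerivAt I 𝓘(ℂ, B) f p L' :=
  (ContinuousLinearMap.ext hL : L = L') ▸ h

/-- A vector-valued function on a complex manifold with vanishing derivative near a point is
constant near that point. -/
theorem eventually_eq_of_hasMFDerivAt_zero {N M B : Type*} [NormedAddCommGroup N]
    [NormedSpace ℂ N] [TopologicalSpace M] [ChartedSpace N M] [IsManifold 𝓘(ℂ, N) ω M]
    [NormedAddCommGroup B] [NormedSpace ℂ B] {f : M → B} {p : M}
    (hf : ∀ᶠ q in nhds p, HasMFDerivAt 𝓘(ℂ, N) 𝓘(ℂ, B) f q (0 : N →L[ℂ] B)) :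
    ∀ᶠ q in nhds p, f q = f p := by
  set e := chartAt N p with he
  have hp : p ∈ e.source := mem_chart_source _ p
  have hsymm : Tendsto e.symm (nhds (e p)) (nhds p) := by
    have := e.continuousAt_symm (e.map_source hp)
    rwa [ContinuousAt, e.left_inv hp] at this
  obtain ⟨r, hr, hball⟩ := Metric.eventually_nhds_iff_ball.1
    ((hsymm.eventually hf).and (e.open_target.mem_nhds (e.map_source hp)))
  have hd : ∀ y ∈ Metric.ball (e p) r, HasFDerivAt (f ∘ e.symm) (0 : N →L[ℂ] B) y := by
    intro y hy
    have h1 := (hball y hy).1.comp y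
      ((mdifferentiable_chart (I := 𝓘(ℂ, N)) p).mdifferentiableAt_symm (hball y hy).2).hasMFDerivAt
    exact (hasMFDerivAt_of_apply_eq (L' := (0 : N →L[ℂ] B)) h1 fun v => rfl).hasFDerivAt
  filter_upwards [e.open_source.mem_nhds hp,
    (e.continuousAt hp).eventually (Metric.ball_mem_nhds _ hr)] with q hq hqr
  have h3 := (Metric.isOpen_ball).is_const_of_fderiv_eq_zero (𝕜 := ℂ)
    (convex_ball (e p) r).isPreconnected
    (fun y hy => (hd y hy).differentiableAt.differentiableWithinAt)
    (fun y hy => (hd y hy).fderiv) hqr (Metric.mem_ball_self hr)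
  simpa [e.left_inv hq, e.left_inv hp] using h3

namespace BranchedCartanGeometry

variable {d : ℕ} {X : Type u} [TopologicalSpace X]
  [ChartedSpace (Fin d → ℂ) X] {F : Type} [NormedAddCommGroup F] [NormedSpace ℂ F]
  {H : Type} [Group H] [TopologicalSpace H] [ChartedSpace F H]
  {W : Type} [NormedAddCommGroup W] [NormedSpace ℂ W] {m : KleinModel F H W}

/-- The derivative of the inverse chart cancels that of the chart. This carries equations solved in
a chart back to the total space. -/
theorem formInChart_mfderiv_chartAt (S : BranchedCartanGeometry.{u, v} d X m)
    {p q : S.bundle.Total} (hq : q ∈ (chartAt ((Fin d → ℂ) × F) p).source)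
    (v : TangentSpace 𝓘(ℂ, (Fin d → ℂ) × F) q) :
    S.formInChart p (chartAt ((Fin d → ℂ) × F) p q)
      (mfderiv 𝓘(ℂ, (Fin d → ℂ) × F) 𝓘(ℂ, (Fin d → ℂ) × F) (chartAt ((Fin d → ℂ) × F) p) q v) =
    S.form q v := by
  have h1 := (mdifferentiable_chart (I := 𝓘(ℂ, (Fin d → ℂ) × F)) p).symm_comp_deriv hq
  have h2 : ∀ q' : S.bundle.Total, q' = q → ∀ w : (Fin d → ℂ) × F,
      S.form q' w = S.form q w := by
    rintro _ rfl w
    rfl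
  rw [formInChart]
  refine (h2 _ ((chartAt ((Fin d → ℂ) × F) p).left_inv hq) _).trans ?_
  exact congrArg (S.form q) (DFunLike.congr_fun h1 v)

/-- In finite dimension it suffices to fix the vector `v`. The evaluation at `v` is then the form,
as a function on the tangent bundle, composed with the tangent map of the inverse chart along a
constant field. -/
theorem contDiffOn_formInChart [FiniteDimensional ℂ F] (S : BranchedCartanGeometry.{u, v} d X m)
    (p : S.bundle.Total) :
    ContDiffOn ℂ ω (S.formInChart p) (chartAt ((Fin d → ℂ) × F) p).target := by
  rw [contDiffOn_clm_apply]
  intro v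
  have hu : UniqueMDiffOn 𝓘(ℂ, (Fin d → ℂ) × F) (chartAt ((Fin d → ℂ) × F) p).target :=
    (chartAt ((Fin d → ℂ) × F) p).open_target.uniqueMDiffOn
  have h1 := (contMDiffOn_chart_symm (I := 𝓘(ℂ, (Fin d → ℂ) × F)) (n := ω)
    (x := p)).contMDiffOn_tangentMapWithin (m := ω) le_rfl hu
  have h2 : ContMDiffOn 𝓘(ℂ, (Fin d → ℂ) × F) 𝓘(ℂ, (Fin d → ℂ) × F).tangent ω
      (fun y => (⟨y, v⟩ : TangentBundle 𝓘(ℂ, (Fin d → ℂ) × F) ((Fin d → ℂ) × F)))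
      (chartAt ((Fin d → ℂ) × F) p).target :=
    contMDiffOn_vectorSpace_iff_contDiffOn.2 contDiffOn_const
  have h3 := S.holomorphic.comp_contMDiffOn (h1.comp h2 fun y hy => hy)
  rw [contMDiffOn_iff_contDiffOn] at h3
  refine h3.congr fun y hy => ?_
  have h4 : mfderivWithin 𝓘(ℂ, (Fin d → ℂ) × F) 𝓘(ℂ, (Fin d → ℂ) × F)
      (chartAt ((Fin d → ℂ) × F) p).symm (chartAt ((Fin d → ℂ) × F) p).target y =
      mfderiv 𝓘(ℂ, (Fin d → ℂ) × F) 𝓘(ℂ, (Fin d → ℂ) × F)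
      (chartAt ((Fin d → ℂ) × F) p).symm y :=
    mfderivWithin_of_isOpen (chartAt ((Fin d → ℂ) × F) p).open_target hy
  simp only [Function.comp_apply, tangentMapWithin, h4]
  rfl

/-- Near every point of the total space of a flat geometry, the form is the logarithmic derivative
of a function with values in the invertible operators. -/
theorem exists_local_frame [FiniteDimensional ℂ F] [CompleteSpace W]
    (S : BranchedCartanGeometry.{u, v} d X m) (hS : S.IsFlat) (p : S.bundle.Total) :
    ∃ f : S.bundle.Total → (W →L[ℂ] W)ˣ, f p = 1 ∧ ∀ᶠ q in nhds p,
      HasMFDerivAt 𝓘(ℂ, (Fin d → ℂ) × F) 𝓘(ℂ, W →L[ℂ] W) (fun q => (f q : W →L[ℂ] W)) q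
        ((ContinuousLinearMap.mul ℂ (W →L[ℂ] W) (f q)).comp (S.form q)) := by
  classical
  set e := chartAt ((Fin d → ℂ) × F) p with he
  have hp : p ∈ e.source := mem_chart_source _ p
  have ht : e.target ∈ nhds (e p) := e.open_target.mem_nhds (e.map_source hp)
  obtain ⟨G, hG1, hG⟩ := exists_eventually_hasFDerivAt_mul (c := e p) (η := S.formInChart p)
    (((S.contDiffOn_formInChart p).contDiffAt ht).of_le le_top)
    (by filter_upwards [ht] with y hy v w using hS p y hy v w)
  have hcont : ContinuousAt (fun q => G (e q)) p :=
    ContinuousAt.comp (f := e) hG.self_of_nhds.continuousAt (e.continuousAt hp)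
  have hunit : ∀ᶠ q in nhds p, IsUnit (G (e q)) :=
    hcont.eventually (Units.isOpen.mem_nhds (by simp [hG1]))
  -- The Frobenius solution is `1` at the center, hence invertible nearby; the value `1` elsewhere
  -- is a dummy.
  let f : S.bundle.Total → (W →L[ℂ] W)ˣ := fun q =>
    if h : IsUnit (G (e q)) then h.unit else 1
  have hf : ∀ q, IsUnit (G (e q)) → (f q : W →L[ℂ] W) = G (e q) := by
    intro q h
    simp [f, h]
  refine ⟨f, Units.ext ?_, ?_⟩
  · rw [hf p hunit.self_of_nhds, hG1, Units.val_one]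
  · filter_upwards [hunit.eventually_nhds, (e.continuousAt hp).eventually hG,
      e.open_source.mem_nhds hp] with q hq1 hq2 hq3
    have h1 := hq2.hasMFDerivAt.comp q
      ((mdifferentiable_chart (I := 𝓘(ℂ, (Fin d → ℂ) × F)) p).mdifferentiableAt hq3).hasMFDerivAt
    have h2 := h1.congr_of_eventuallyEq (f₁ := fun q => (f q : W →L[ℂ] W)) (hq1.mono hf)
    refine hasMFDerivAt_of_apply_eq h2 fun v => ?_
    rw [hf q hq1.self_of_nhds]
    exact congrArg (G (e q) * ·) (S.formInChart_mfderiv_chartAt hq3 v)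

end BranchedCartanGeometry

end BranchedCartan

/-! ### Flat sections of the adjoint bundle: uniqueness and local existence -/

namespace BranchedCartan

open Set Filter

section

variable {A : Type*} [NormedRing A] [NormedAlgebra ℂ A]

/-- The commutator with `c`, as a continuous linear map: `x ↦ c * x - x * c`. -/
noncomputable def commutator (c : A) : A →L[ℂ] A :=
  ContinuousLinearMap.mul ℂ A c - (ContinuousLinearMap.mul ℂ A).flip c

theorem commutator_apply (c x : A) : commutator c x = c * x - x * c := rfl

/-- The derivative of `f⁻¹ a f`. -/
theorem hasMFDerivAt_units_conj [CompleteSpace A] {N G M : Type*} [NormedAddCommGroup N]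
    [NormedSpace ℂ N] [TopologicalSpace G] {I : ModelWithCorners ℂ N G} [TopologicalSpace M]
    [ChartedSpace G M] {f : M → Aˣ} {q : M} {L : TangentSpace I q →L[ℂ] A}
    (hf : HasMFDerivAt I 𝓘(ℂ, A) (fun q => (f q : A)) q L) (a : A)
    {L' : TangentSpace I q →L[ℂ] A}
    (hL : ∀ v, L' v = commutator (↑(f q)⁻¹ * a * f q) (↑(f q)⁻¹ * L v)) :
    HasMFDerivAt I 𝓘(ℂ, A) (fun q => ↑(f q)⁻¹ * a * (f q : A)) q L' := by
  have h1 : HasFDerivAt (fun x : A => Ring.inverse x * a * x) _ (f q : A) :=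
    ((hasFDerivAt_ringInverse (𝕜 := ℂ) (f q)).mul_const' a).mul' (hasFDerivAt_id (f q : A))
  have h2 := h1.hasMFDerivAt.comp q hf
  have h3 : ((fun x : A => Ring.inverse x * a * x) ∘ fun q => (f q : A)) =
      fun q => ↑(f q)⁻¹ * a * (f q : A) := by
    ext q
    simp
  rw [h3] at h2
  refine hasMFDerivAt_of_apply_eq h2 fun v => ?_
  rw [hL]
  have h4 : ∀ x : A, (Ring.inverse (f q : A) * a) * x + -(↑(f q)⁻¹ * x * ↑(f q)⁻¹) * a * (f q : A) =
      commutator (↑(f q)⁻¹ * a * f q) (↑(f q)⁻¹ * x) := by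
    intro x
    rw [commutator_apply, Ring.inverse_unit]
    simp only [mul_assoc, Units.mul_inv_cancel_left]
    noncomm_ring
  exact h4 (L v)

end

variable {d : ℕ} {X : Type u} [TopologicalSpace X]
  [ChartedSpace (Fin d → ℂ) X] {F : Type} [NormedAddCommGroup F] [NormedSpace ℂ F]
  {H : Type} [Group H] [TopologicalSpace H] [ChartedSpace F H]
  {W : Type} [NormedAddCommGroup W] [NormedSpace ℂ W] {m : KleinModel F H W}

/-- A linear representation of the structure group which induces the adjoint action, and whose
derivative is the inclusion of Lie algebras up to central operators. -/
structure Linearization (m : KleinModel F H W) where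
  rep : H →* (W →L[ℂ] W)ˣ
  Ad_eq : ∀ h M, m.Ad h M = rep h * M * ↑(rep h)⁻¹
  repDeriv : F →L[ℂ] (W →L[ℂ] W)
  hasMFDerivAt_rep : HasMFDerivAt 𝓘(ℂ, F) 𝓘(ℂ, W →L[ℂ] W)
    (fun h => (rep h : W →L[ℂ] W)) 1 repDeriv
  commutator_repDeriv : ∀ M w, commutator M (repDeriv w) = commutator M (m.incl w)

namespace HolomorphicPrincipalBundle

variable (E : HolomorphicPrincipalBundle.{u, v} d X F H)

/-- In a local trivialization the group element is the quotient of the two fiber coordinates. -/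
theorem exists_act_eq {q q' : E.Total} (h : E.proj q = E.proj q') : ∃ k, q' = E.act q k := by
  obtain ⟨e, hx, -, -, he⟩ := E.locallyTrivial (E.proj q)
  have hq : q ∈ e.source := e.mem_source.2 hx
  have hq' : q' ∈ e.source := e.mem_source.2 (h ▸ hx)
  refine ⟨(e q).2⁻¹ * (e q').2, e.injOn hq' (e.mem_source.2 (by rwa [E.proj_act])) ?_⟩
  change e q' = e _
  rw [he q hq, mul_inv_cancel_left]
  refine Prod.ext ?_ rfl
  rw [e.coe_fst hq, e.coe_fst hq', h]

theorem proj_surjective : Function.Surjective E.proj := by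
  intro x
  obtain ⟨e, hx, -⟩ := E.locallyTrivial x
  exact ⟨e.toOpenPartialHomeomorph.symm (x, 1), e.proj_symm_apply' hx⟩

/-- Used to push statements that hold near a point of the total space down to `X`, and to see that
the projection is open. -/
theorem map_proj_nhds (q : E.Total) : map E.proj (nhds q) = nhds (E.proj q) := by
  obtain ⟨e, hx, -⟩ := E.locallyTrivial (E.proj q)
  exact e.map_proj_nhds (e.mem_source.2 hx)

theorem continuous_proj : Continuous E.proj := E.contMDiff_proj.continuous

theorem mdifferentiableAt_act (h : H) (q : E.Total) :
    MDifferentiableAt 𝓘(ℂ, (Fin d → ℂ) × F) 𝓘(ℂ, (Fin d → ℂ) × F) (fun y => E.act y h) q := by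
  have h1 : MDifferentiableAt (𝓘(ℂ, (Fin d → ℂ) × F).prod 𝓘(ℂ, F)) 𝓘(ℂ, (Fin d → ℂ) × F)
      (fun y : E.Total × H => E.act y.1 y.2) (q, h) :=
    E.contMDiff_act.mdifferentiableAt (by simp)
  exact h1.comp (f := fun y : E.Total => (y, h)) q
    (mdifferentiableAt_id.prodMk mdifferentiableAt_const)

theorem continuous_act (h : H) : Continuous (fun y => E.act y h) :=
  continuous_iff_continuousAt.2 fun q => (E.mdifferentiableAt_act h q).continuousAt

end HolomorphicPrincipalBundle

namespace BranchedCartanGeometry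

variable (S : BranchedCartanGeometry.{u, v} d X m) (ℓ : Linearization m)

/-- A flat section, over a subset `U` of `X`, of the adjoint bundle: an equivariant function on the
total space which satisfies `dφ = [φ, β]`. -/
structure IsFlatSection (U : Set X) (φ : S.bundle.Total → (W →L[ℂ] W)) : Prop where
  hasMFDerivAt : ∀ q, S.bundle.proj q ∈ U →
    HasMFDerivAt 𝓘(ℂ, (Fin d → ℂ) × F) 𝓘(ℂ, W →L[ℂ] W) φ q ((commutator (φ q)).comp (S.form q))
  apply_act : ∀ q h, S.bundle.proj q ∈ U →
    φ (S.bundle.act q h) = ↑(ℓ.rep h)⁻¹ * φ q * ℓ.rep h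

variable {S ℓ}

theorem IsFlatSection.congr {U : Set X} (hU : IsOpen U) {φ ψ : S.bundle.Total → (W →L[ℂ] W)}
    (hφ : S.IsFlatSection ℓ U φ) (h : ∀ q, S.bundle.proj q ∈ U → ψ q = φ q) :
    S.IsFlatSection ℓ U ψ where
  hasMFDerivAt q hq := by
    rw [h q hq]
    refine (hφ.hasMFDerivAt q hq).congr_of_eventuallyEq ?_
    exact ((hU.preimage S.bundle.continuous_proj).mem_nhds hq : _ ∈ nhds q)
      |> Filter.Eventually.mono (p := fun q => S.bundle.proj q ∈ U) |> fun k => k (h ·)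
  apply_act q k hq := by
    rw [h q hq, h _ (by rwa [S.bundle.proj_act]), hφ.apply_act q k hq]

theorem IsFlatSection.mono {U U' : Set X} {φ : S.bundle.Total → (W →L[ℂ] W)}
    (hφ : S.IsFlatSection ℓ U φ) (h : U' ⊆ U) : S.IsFlatSection ℓ U' φ :=
  ⟨fun q hq => hφ.hasMFDerivAt q (h hq), fun q k hq => hφ.apply_act q k (h hq)⟩

/-- Two flat sections which agree at one point agree over a neighborhood of its projection. -/
theorem IsFlatSection.eventually_eq [FiniteDimensional ℂ F] [CompleteSpace W] (hS : S.IsFlat)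
    {U : Set X} (hU : IsOpen U)
    {φ ψ : S.bundle.Total → (W →L[ℂ] W)} (hφ : S.IsFlatSection ℓ U φ)
    (hψ : S.IsFlatSection ℓ U ψ) {q : S.bundle.Total} (hq : S.bundle.proj q ∈ U)
    (h : φ q = ψ q) :
    ∀ᶠ x in nhds (S.bundle.proj q), ∀ q', S.bundle.proj q' = x → φ q' = ψ q' := by
  obtain ⟨f, -, hf⟩ := S.exists_local_frame hS q
  -- From `df = f β` and `dχ = [χ, β]` the derivative of `f χ f⁻¹` vanishes, so near `q` a flat
  -- section is determined by its value at `q`. Equivariance then extends the agreement to whole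
  -- fibers.
  have hzero : ∀ χ : S.bundle.Total → (W →L[ℂ] W), S.IsFlatSection ℓ U χ →
      ∀ᶠ q' in nhds q, ↑(f q') * χ q' * ↑(f q')⁻¹ = (f q * χ q * ↑(f q)⁻¹ : W →L[ℂ] W) := by
    intro χ hχ
    refine eventually_eq_of_hasMFDerivAt_zero (N := (Fin d → ℂ) × F) ?_
    filter_upwards [hf, (hU.preimage S.bundle.continuous_proj).mem_nhds hq] with q' hf' hq'
    have h1 : HasFDerivAt (fun x : W →L[ℂ] W => Ring.inverse x) _ (f q' : W →L[ℂ] W) :=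
      hasFDerivAt_ringInverse (𝕜 := ℂ) (f q')
    have h2 := h1.hasMFDerivAt.comp q' hf'
    have h3 := (hf'.mul' (hχ.hasMFDerivAt q' hq')).mul' h2
    have h4 : ((fun q' => (f q' : W →L[ℂ] W)) * χ * (fun x => Ring.inverse x) ∘
        fun q' => (f q' : W →L[ℂ] W)) = fun q' => ↑(f q') * χ q' * ↑(f q')⁻¹ := by
      ext1 q'
      simp
    rw [h4] at h3
    refine hasMFDerivAt_of_apply_eq h3 fun v => ?_
    have h5 : ∀ b : W →L[ℂ] W, (f q' * χ q') * -(↑(f q')⁻¹ * (f q' * b) * ↑(f q')⁻¹) +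
        (f q' * (χ q' * b - b * χ q') + (f q' * b) * χ q') * Ring.inverse (f q' : W →L[ℂ] W) =
        0 := by
      intro b
      rw [Ring.inverse_unit]
      simp only [Units.inv_mul_cancel_left]
      noncomm_ring
    exact h5 (S.form q' v)
  rw [← S.bundle.map_proj_nhds, eventually_map]
  filter_upwards [hzero φ hφ, hzero ψ hψ, (hU.preimage S.bundle.continuous_proj).mem_nhds hq]
    with q₁ h₁ h₂ hq₁ q' hq'
  rw [h, ← h₂] at h₁
  have h₃ : φ q₁ = ψ q₁ := (Units.mul_right_inj _).1 ((Units.mul_left_inj _).1 h₁)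
  obtain ⟨k, rfl⟩ := S.bundle.exists_act_eq hq'.symm
  rw [hφ.apply_act _ _ hq₁, hψ.apply_act _ _ hq₁, h₃]

/-- The axiom `vertical` lives at the point `act q 1`; here it is transported to `q` itself. -/
theorem form_act_one (q : S.bundle.Total) (w : F) :
    S.form q (mfderiv 𝓘(ℂ, F) 𝓘(ℂ, (Fin d → ℂ) × F) (fun h : H => S.bundle.act q h) 1 w) =
      m.incl w := by
  have h : ∀ q' : S.bundle.Total, q' = q → ∀ w : (Fin d → ℂ) × F,
      S.form q' w = S.form q w := by
    rintro _ rfl w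
    rfl
  rw [← S.vertical q w]
  exact (h _ (S.bundle.act_one q) _).symm

variable (ℓ) in
/-- An equivariant function satisfies `dφ = [φ, β]` along a whole fiber if it does so at one point
of the fiber. -/
theorem hasMFDerivAt_act {U : Set X} (hU : IsOpen U) {φ : S.bundle.Total → (W →L[ℂ] W)}
    (hφ : ∀ q h, S.bundle.proj q ∈ U → φ (S.bundle.act q h) = ↑(ℓ.rep h)⁻¹ * φ q * ℓ.rep h)
    {q : S.bundle.Total} (hq : S.bundle.proj q ∈ U)
    (h : HasMFDerivAt 𝓘(ℂ, (Fin d → ℂ) × F) 𝓘(ℂ, W →L[ℂ] W) φ q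
      ((commutator (φ q)).comp (S.form q))) (k : H) :
    HasMFDerivAt 𝓘(ℂ, (Fin d → ℂ) × F) 𝓘(ℂ, W →L[ℂ] W) φ (S.bundle.act q k)
      ((commutator (φ (S.bundle.act q k))).comp (S.form (S.bundle.act q k))) := by
  have hq1 : S.bundle.act (S.bundle.act q k) k⁻¹ = q := by
    rw [← S.bundle.act_mul, mul_inv_cancel, S.bundle.act_one]
  have hq' : S.bundle.proj (S.bundle.act q k) ∈ U := by rwa [S.bundle.proj_act]
  set q' := S.bundle.act q k with hq'def
  rw [← hq1] at h
  have h1 := h.comp q' (S.bundle.mdifferentiableAt_act k⁻¹ q').hasMFDerivAt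
  have h2 : HasFDerivAt (fun x : W →L[ℂ] W => ↑(ℓ.rep k)⁻¹ * x * (ℓ.rep k : W →L[ℂ] W)) _
      (φ (S.bundle.act q' k⁻¹)) :=
    ((hasFDerivAt_id (𝕜 := ℂ) (φ (S.bundle.act q' k⁻¹))).const_mul (↑(ℓ.rep k)⁻¹ : W →L[ℂ] W)).mul_const'
      (ℓ.rep k : W →L[ℂ] W)
  have h3 := h2.hasMFDerivAt.comp q' h1
  -- By equivariance, near `q'` the function is its translate by `k⁻¹`, conjugated by `ρ(k)`; the
  -- equivariance of `β` turns the differentiated identity into the equation at `q'`.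
  have h4 : ∀ᶠ y in nhds q', φ y = ↑(ℓ.rep k)⁻¹ * φ (S.bundle.act y k⁻¹) * (ℓ.rep k) := by
    filter_upwards [(hU.preimage S.bundle.continuous_proj).mem_nhds hq'] with y hy
    rw [hφ y k⁻¹ hy, map_inv, inv_inv]
    simp only [mul_assoc, Units.inv_mul_cancel_left, Units.inv_mul, mul_one]
  refine hasMFDerivAt_of_apply_eq (h3.congr_of_eventuallyEq h4) fun v => ?_
  have h5 : ∀ b : W →L[ℂ] W, ↑(ℓ.rep k)⁻¹ * commutator (φ (S.bundle.act q' k⁻¹)) b * ℓ.rep k =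
      commutator (φ q') (↑(ℓ.rep k)⁻¹ * b * ℓ.rep k) := by
    intro b
    rw [h4.self_of_nhds, commutator_apply, commutator_apply]
    simp only [mul_sub, sub_mul, mul_assoc, Units.mul_inv_cancel_left]
  refine (h5 _).trans (congrArg (commutator (φ q')) ?_)
  have h6 := S.equivariant k⁻¹ q' v
  rw [inv_inv, ℓ.Ad_eq] at h6
  refine (congrArg (fun b => (↑(ℓ.rep k)⁻¹ : W →L[ℂ] W) * b * ℓ.rep k) h6).trans ?_
  simp only [mul_assoc, Units.inv_mul_cancel_left, Units.inv_mul, mul_one]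
  rfl

/-- Local existence of flat sections. -/
theorem exists_isFlatSection_conj [FiniteDimensional ℂ F] [CompleteSpace W]
    (ℓ : Linearization m) (hS : S.IsFlat) (x₀ : X) :
    ∃ U : Set X, IsOpen U ∧ x₀ ∈ U ∧ ∃ g : S.bundle.Total → (W →L[ℂ] W)ˣ, ∀ a : W →L[ℂ] W,
      S.IsFlatSection ℓ U (fun q => ↑(g q)⁻¹ * a * g q) := by
  obtain ⟨e, hx₀, he1, he2, he3⟩ := S.bundle.locallyTrivial x₀
  let s : X → S.bundle.Total := fun x => e.toOpenPartialHomeomorph.symm (x, 1)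
  have hs_proj : ∀ x ∈ e.baseSet, S.bundle.proj (s x) = x := fun x hx => e.proj_symm_apply' hx
  have hs_source : ∀ x ∈ e.baseSet, s x ∈ e.source := fun x hx =>
    e.mem_source.2 (by rwa [hs_proj x hx])
  have hs_apply : ∀ x ∈ e.baseSet, e (s x) = (x, 1) := fun x hx => e.apply_symm_apply' hx
  have hsymm_act : ∀ x ∈ e.baseSet, ∀ h, e.toOpenPartialHomeomorph.symm (x, h) =
      S.bundle.act (s x) h := by
    intro x hx h
    refine e.injOn (e.map_target (e.mem_target.2 hx))
      (e.mem_source.2 (by rwa [S.bundle.proj_act, hs_proj x hx])) ?_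
    change e _ = e _
    rw [he3 _ (hs_source x hx), hs_apply x hx, one_mul]
    exact e.apply_symm_apply' hx
  have hact_s : ∀ q ∈ e.source, q = S.bundle.act (s (S.bundle.proj q)) (e q).2 := by
    intro q hq
    rw [← hsymm_act _ (e.mem_source.1 hq), ← e.coe_fst hq]
    exact (e.left_inv hq).symm
  have hsd : ∀ x ∈ e.baseSet, MDifferentiableAt 𝓘(ℂ, Fin d → ℂ) 𝓘(ℂ, (Fin d → ℂ) × F) s x := by
    intro x hx
    have h1 : MDifferentiableAt (𝓘(ℂ, Fin d → ℂ).prod 𝓘(ℂ, F)) 𝓘(ℂ, (Fin d → ℂ) × F)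
        e.toOpenPartialHomeomorph.symm (x, 1) :=
      (he2.contMDiffAt (e.open_target.mem_nhds (e.mem_target.2 hx))).mdifferentiableAt (by simp)
    exact h1.comp (f := fun y : X => (y, (1 : H))) x
      (mdifferentiableAt_id.prodMk mdifferentiableAt_const)
  obtain ⟨f, -, hf⟩ := S.exists_local_frame hS (s x₀)
  obtain ⟨O, hO, hOo, hsO⟩ := eventually_nhds_iff.1 hf
  have hs_cont : ContinuousOn s e.baseSet := fun x hx => (hsd x hx).continuousAt.continuousWithinAt
  let U : Set X := e.baseSet ∩ s ⁻¹' O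
  have hU : IsOpen U := hs_cont.isOpen_inter_preimage e.open_baseSet hOo
  -- The frame is kept only along the section `s` and extended over the fibers by the
  -- representation, which makes equivariance exact. The price is that `dg = g β` may fail by
  -- central terms along the fibers; these disappear in `g⁻¹ a g`.
  let g : S.bundle.Total → (W →L[ℂ] W)ˣ := fun q => f (s (S.bundle.proj q)) * ℓ.rep (e q).2
  refine ⟨U, hU, ⟨hx₀, hsO⟩, g, fun a => ?_⟩
  have hequiv : ∀ q h, S.bundle.proj q ∈ U →
      (↑(g (S.bundle.act q h))⁻¹ * a * g (S.bundle.act q h) : W →L[ℂ] W) =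
        ↑(ℓ.rep h)⁻¹ * (↑(g q)⁻¹ * a * g q) * ℓ.rep h := by
    intro q h hq
    have h1 : g (S.bundle.act q h) = g q * ℓ.rep h := by
      simp only [g, S.bundle.proj_act, he3 q (e.mem_source.2 hq.1), map_mul, mul_assoc]
    rw [h1, mul_inv_rev, Units.val_mul, Units.val_mul]
    simp only [mul_assoc]
  have hparallel : ∀ x ∈ U, HasMFDerivAt 𝓘(ℂ, (Fin d → ℂ) × F) 𝓘(ℂ, W →L[ℂ] W)
      (fun q => (↑(g q)⁻¹ * a * g q : W →L[ℂ] W)) (s x)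
      ((commutator (↑(g (s x))⁻¹ * a * g (s x) : W →L[ℂ] W)).comp (S.form (s x))) := by
    intro x hx
    have hb := hx.1
    have hgx : g (s x) = f (s x) := by
      simp only [g, hs_proj x hb, hs_apply x hb, map_one, mul_one]
    have he : e.toOpenPartialHomeomorph.MDifferentiable 𝓘(ℂ, (Fin d → ℂ) × F)
        (𝓘(ℂ, Fin d → ℂ).prod 𝓘(ℂ, F)) :=
      ⟨he1.mdifferentiableOn (by simp), he2.mdifferentiableOn (by simp)⟩
    have hde := he.mdifferentiableAt (hs_source x hb)
    -- the derivative of `g`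
    have hfs := (hO (s x) hx.2).comp x (hsd x hb).hasMFDerivAt
    have h1 := hfs.comp (x, (1 : H)) (hasMFDerivAt_fst
      (I := 𝓘(ℂ, Fin d → ℂ)) (I' := 𝓘(ℂ, F)) (x, (1 : H)))
    have h2 := ℓ.hasMFDerivAt_rep.comp (x, (1 : H)) (hasMFDerivAt_snd
      (I := 𝓘(ℂ, Fin d → ℂ)) (I' := 𝓘(ℂ, F)) (x, (1 : H)))
    let L : (Fin d → ℂ) × F →L[ℂ] (W →L[ℂ] W) :=
      ((ContinuousLinearMap.mul ℂ (W →L[ℂ] W) (f (s x))).comp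
        ((S.form (s x)).comp (mfderiv 𝓘(ℂ, Fin d → ℂ) 𝓘(ℂ, (Fin d → ℂ) × F) s x))).comp
          (ContinuousLinearMap.fst ℂ (Fin d → ℂ) F) +
      ((ContinuousLinearMap.mul ℂ (W →L[ℂ] W) (f (s x))).comp ℓ.repDeriv).comp
        (ContinuousLinearMap.snd ℂ (Fin d → ℂ) F)
    have h3 : HasMFDerivAt (𝓘(ℂ, Fin d → ℂ).prod 𝓘(ℂ, F)) 𝓘(ℂ, W →L[ℂ] W)
        (fun y : X × H => (f (s y.1) * ℓ.rep y.2 : W →L[ℂ] W)) (x, 1) L := by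
      refine hasMFDerivAt_of_apply_eq (h1.mul' h2) fun u => ?_
      have h (b c : W →L[ℂ] W) : f (s x) * c + f (s x) * b * ℓ.rep 1 = f (s x) * b + f (s x) * c := by
        rw [map_one, Units.val_one, mul_one, add_comm]
      exact h _ _
    have h4 : HasMFDerivAt (𝓘(ℂ, Fin d → ℂ).prod 𝓘(ℂ, F)) 𝓘(ℂ, W →L[ℂ] W)
        (fun y : X × H => (f (s y.1) * ℓ.rep y.2 : W →L[ℂ] W)) (e (s x)) L := by
      rw [hs_apply x hb]
      exact h3
    have h5 := h4.comp (s x) hde.hasMFDerivAt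
    have h6 : (fun q => (g q : W →L[ℂ] W)) =ᶠ[nhds (s x)]
        (fun y : X × H => (f (s y.1) * ℓ.rep y.2 : W →L[ℂ] W)) ∘ e := by
      filter_upwards [e.open_source.mem_nhds (hs_source x hb)] with q hq
      simp only [g, Function.comp_apply, e.coe_fst hq, Units.val_mul]
    have h7 := h5.congr_of_eventuallyEq h6
    refine hasMFDerivAt_units_conj h7 a fun v => ?_
    -- decomposition of a tangent vector
    set D := mfderiv 𝓘(ℂ, (Fin d → ℂ) × F) (𝓘(ℂ, Fin d → ℂ).prod 𝓘(ℂ, F))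
      e.toOpenPartialHomeomorph (s x) with hD
    have hform : ∀ u : (Fin d → ℂ) × F,
        S.form (s x) (mfderiv (𝓘(ℂ, Fin d → ℂ).prod 𝓘(ℂ, F)) 𝓘(ℂ, (Fin d → ℂ) × F)
          e.toOpenPartialHomeomorph.symm (x, 1) u) =
        S.form (s x) (mfderiv 𝓘(ℂ, Fin d → ℂ) 𝓘(ℂ, (Fin d → ℂ) × F) s x u.1) + m.incl u.2 := by
      intro u
      rw [← S.form_act_one]
      refine Eq.trans ?_ (map_add (S.form (s x)) _ _)
      refine congrArg (S.form (s x)) ?_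
      refine (mfderiv_prod_eq_add_apply (he.mdifferentiableAt_symm (e.mem_target.2 hb))).trans ?_
      have h : (fun k : H => e.toOpenPartialHomeomorph.symm (x, k)) =
          fun k => S.bundle.act (s x) k := funext fun k => hsymm_act x hb k
      have h' : ∀ f₁ f₂ : H → S.bundle.Total, f₁ = f₂ → ∀ w : F,
          (mfderiv 𝓘(ℂ, F) 𝓘(ℂ, (Fin d → ℂ) × F) f₁ 1 w : (Fin d → ℂ) × F) =
            mfderiv 𝓘(ℂ, F) 𝓘(ℂ, (Fin d → ℂ) × F) f₂ 1 w := by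
        rintro _ _ rfl w
        rfl
      have h'' (a b c : (Fin d → ℂ) × F) (hbc : b = c) : a + b = a + c := by rw [hbc]
      exact h'' _ _ _ (h' _ _ h u.2)
    have hv : S.form (s x) v = S.form (s x)
        (mfderiv 𝓘(ℂ, Fin d → ℂ) 𝓘(ℂ, (Fin d → ℂ) × F) s x (D v).1) + m.incl (D v).2 := by
      refine Eq.trans ?_ (hform (D v))
      refine congrArg (S.form (s x)) ?_
      have h8 := DFunLike.congr_fun (he.symm_comp_deriv (hs_source x hb)) v
      have h9 : e.toOpenPartialHomeomorph (s x) = (x, 1) := hs_apply x hb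
      rw [h9] at h8
      exact h8.symm
    -- The commutator does not see the central difference between `ℓ.repDeriv` and `m.incl`.
    have hfinal (b : W →L[ℂ] W) (w : F) (M : W →L[ℂ] W) : commutator M (b + m.incl w) =
        commutator M (↑(f (s x))⁻¹ * (f (s x) * b + f (s x) * ℓ.repDeriv w)) := by
      rw [mul_add, Units.inv_mul_cancel_left, Units.inv_mul_cancel_left, map_add, map_add,
        ℓ.commutator_repDeriv]
    refine (congrArg (commutator _) hv).trans ?_
    rw [hgx]
    exact hfinal _ _ _
  refine ⟨fun q hq => ?_, hequiv⟩
  have h1 := hact_s q (e.mem_source.2 hq.1)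
  have h2 := hasMFDerivAt_act ℓ hU hequiv (q := s (S.bundle.proj q))
    (by rwa [hs_proj _ hq.1]) (hparallel _ hq) (e q).2
  rwa [← h1] at h2

end BranchedCartanGeometry

end BranchedCartan

/-! ### Analyticity, the identity theorem and global flat sections -/

namespace BranchedCartan

open Set Filter

section

variable {N M B : Type*} [NormedAddCommGroup N] [NormedSpace ℂ N] [TopologicalSpace M]
  [ChartedSpace N M] [IsManifold 𝓘(ℂ, N) ω M] [NormedAddCommGroup B] [NormedSpace ℂ B]

/-- Holomorphic functions with values in a Banach space are analytic. -/
theorem contMDiff_of_mdifferentiable [FiniteDimensional ℂ N] [CompleteSpace B] {f : M → B}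
    (hf : MDifferentiable 𝓘(ℂ, N) 𝓘(ℂ, B) f) : ContMDiff 𝓘(ℂ, N) 𝓘(ℂ, B) ω f := by
  intro p
  set e := chartAt N p with he
  have hp : p ∈ e.source := mem_chart_source _ p
  have h1 : ∀ᶠ y in nhds (e p), DifferentiableAt ℂ (f ∘ e.symm) y := by
    filter_upwards [e.open_target.mem_nhds (e.map_source hp)] with y hy
    exact mdifferentiableAt_iff_differentiableAt.1 ((hf _).comp y
      ((mdifferentiable_chart (I := 𝓘(ℂ, N)) p).mdifferentiableAt_symm hy))
  have h2 : ContDiffAt ℂ ω (f ∘ e.symm) (e p) :=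
    (analyticAt_of_eventually_differentiableAt h1).contDiffAt
  have h3 : ContMDiffAt 𝓘(ℂ, N) 𝓘(ℂ, N) ω e p :=
    (contMDiffOn_chart (I := 𝓘(ℂ, N)) (n := ω) (x := p)).contMDiffAt (e.open_source.mem_nhds hp)
  refine (h2.contMDiffAt.comp p h3).congr_of_eventuallyEq ?_
  filter_upwards [e.open_source.mem_nhds hp] with q hq
  simp [e.left_inv hq]

/-- The identity theorem: the set of points near which an analytic function vanishes is closed. -/
theorem isClosed_setOf_eventually_eq_zero {f : M → B} (hf : ContMDiff 𝓘(ℂ, N) 𝓘(ℂ, B) ω f) :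
    IsClosed {p | ∀ᶠ q in nhds p, f q = 0} := by
  refine isClosed_of_closure_subset fun p hp => ?_
  set e := chartAt N p with he
  have hpe : p ∈ e.source := mem_chart_source _ p
  obtain ⟨r, hr, hball⟩ := Metric.eventually_nhds_iff_ball.1
    (e.open_target.mem_nhds (e.map_source hpe))
  have hc : ContDiffOn ℂ ω (f ∘ e.symm) (Metric.ball (e p) r) :=
    contMDiffOn_iff_contDiffOn.1 (hf.comp_contMDiffOn
      ((contMDiffOn_chart_symm (I := 𝓘(ℂ, N)) (n := ω) (x := p)).mono hball))
  have ha : AnalyticOnNhd ℂ (f ∘ e.symm) (Metric.ball (e p) r) := by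
    intro y hy
    exact (hc.contDiffAt (Metric.isOpen_ball.mem_nhds hy)).analyticAt
  have hnhds : e.source ∩ e ⁻¹' Metric.ball (e p) r ∈ nhds p :=
    inter_mem (e.open_source.mem_nhds hpe)
      ((e.continuousAt hpe).preimage_mem_nhds (Metric.ball_mem_nhds _ hr))
  obtain ⟨q, ⟨hqe, hqr⟩, hq⟩ := mem_closure_iff_nhds.1 hp _ hnhds
  have hz : f ∘ e.symm =ᶠ[nhds (e q)] 0 := by
    have : Tendsto e.symm (nhds (e q)) (nhds q) := by
      have := e.continuousAt_symm (e.map_source hqe)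
      rwa [ContinuousAt, e.left_inv hqe] at this
    exact this.eventually hq
  have hzero := ha.eqOn_zero_of_preconnected_of_eventuallyEq_zero
    (convex_ball (e p) r).isPreconnected hqr hz
  filter_upwards [hnhds] with y hy
  simpa [e.left_inv hy.1] using hzero hy.2

end

namespace BranchedCartanGeometry

variable {d : ℕ} {X : Type u} [TopologicalSpace X]
  [ChartedSpace (Fin d → ℂ) X] {F : Type} [NormedAddCommGroup F] [NormedSpace ℂ F]
  {H : Type} [Group H] [TopologicalSpace H] [ChartedSpace F H]
  {W : Type} [NormedAddCommGroup W] [NormedSpace ℂ W] {m : KleinModel F H W}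
  {S : BranchedCartanGeometry.{u, v} d X m} {ℓ : Linearization m}
  {φ ψ : S.bundle.Total → (W →L[ℂ] W)}

/-- On a simply connected manifold, a flat geometry has a global flat section of the adjoint bundle
with any prescribed value at a point. -/
theorem exists_isFlatSection_univ [FiniteDimensional ℂ F] [CompleteSpace W]
    [SimplyConnectedSpace X] (ℓ : Linearization m) (hS : S.IsFlat) (p₀ : S.bundle.Total)
    (a₀ : W →L[ℂ] W) :
    ∃ φ : S.bundle.Total → (W →L[ℂ] W), S.IsFlatSection ℓ univ φ ∧ φ p₀ = a₀ := by
  have : LocallyPathConnectedSpace X := ChartedSpace.locallyPathConnectedSpace (Fin d → ℂ) X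
  choose U hU hxU g hg using S.exists_isFlatSection_conj ℓ hS
  choose p hp using S.bundle.proj_surjective
  -- Over `U i` flat sections are labelled by their constant `a`; `c i j x a` is the label over `U
  -- j` of the section with the same value at `p x`. The choice of `p` need not be continuous, since
  -- equivariance spreads agreement over the fiber.
  let c : X → X → X → (W →L[ℂ] W) → (W →L[ℂ] W) := fun i j x a =>
    g j (p x) * (↑(g i (p x))⁻¹ * a * g i (p x)) * ↑(g j (p x))⁻¹
  have hc : ∀ i j x a b, c i j x a = b ↔
      (↑(g i (p x))⁻¹ * a * g i (p x) : W →L[ℂ] W) = ↑(g j (p x))⁻¹ * b * g j (p x) := by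
    intro i j x a b
    simp only [c]
    rw [Units.mul_inv_eq_iff_eq_mul, ← Units.eq_inv_mul_iff_mul_eq, mul_assoc _ b]
  obtain ⟨b, hb0, hb⟩ := exists_section_of_locallyConstant_cocycle U hU id hxU c
    (fun i x hx a => (hc ..).2 rfl) (fun i j k x hx a => ((hc ..).2 (by
      rw [← (hc i j x a _).1 rfl, ← (hc i k x a _).1 rfl])))
    (fun i j x hx a => by
      have h1 := (((hg i a).mono inter_subset_left).eventually_eq hS ((hU i).inter (hU j))
        ((hg j (c i j x a)).mono inter_subset_right) (q := p x) (by rwa [hp])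
        ((hc ..).1 rfl))
      rw [hp] at h1
      filter_upwards [h1] with y hy
      exact (hc ..).2 (hy (p y) (hp y)))
    (S.bundle.proj p₀) (g (S.bundle.proj p₀) p₀ * a₀ * ↑(g (S.bundle.proj p₀) p₀)⁻¹)
  -- Each point uses the local section indexed by its own projection. By local constancy of the
  -- labels, this coincides near `x` with the single local section labelled `b x`.
  let φ : S.bundle.Total → (W →L[ℂ] W) := fun q =>
    ↑(g (S.bundle.proj q) q)⁻¹ * b (S.bundle.proj q) * g (S.bundle.proj q) q
  have hφ : ∀ x, ∃ O : Set X, IsOpen O ∧ x ∈ O ∧ S.IsFlatSection ℓ O φ := by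
    intro x
    obtain ⟨O, hO, hOo, hxO⟩ := eventually_nhds_iff.1 (hb x x (hxU x))
    refine ⟨O ∩ U x, hOo.inter (hU x), ⟨hxO, hxU x⟩,
      ((hg x (b x)).mono inter_subset_right).congr (hOo.inter (hU x)) fun q hq => ?_⟩
    have h1 := hO _ hq.1
    simp only [id] at h1
    have h2 : c x x x (b x) = b x := (hc ..).2 rfl
    rw [h2, hc] at h1
    obtain ⟨k, hk⟩ := S.bundle.exists_act_eq (hp (S.bundle.proj q))
    have h3 := (hg (S.bundle.proj q) (b (S.bundle.proj q))).apply_act (p (S.bundle.proj q)) k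
      (by rw [hp]; exact hxU _)
    have h4 := (hg x (b x)).apply_act (p (S.bundle.proj q)) k (by rw [hp]; exact hq.2)
    rw [← hk] at h3 h4
    simp only [φ]
    rw [h3, h4, h1]
  refine ⟨φ, ⟨fun q _ => ?_, fun q k _ => ?_⟩, ?_⟩
  · obtain ⟨O, -, hq, hO⟩ := hφ (S.bundle.proj q)
    exact hO.hasMFDerivAt q hq
  · obtain ⟨O, -, hq, hO⟩ := hφ (S.bundle.proj q)
    exact hO.apply_act q k hq
  · simp only [φ, hb0]
    simp only [mul_assoc, Units.inv_mul_cancel_left, Units.inv_mul, mul_one]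

/-- Commutation with `β` is a derivation and conjugation is multiplicative. Together with
uniqueness, this propagates algebraic identities from one point to all. -/
theorem IsFlatSection.mul {U : Set X} (hφ : S.IsFlatSection ℓ U φ) (hψ : S.IsFlatSection ℓ U ψ) :
    S.IsFlatSection ℓ U (φ * ψ) where
  hasMFDerivAt q hq := by
    refine hasMFDerivAt_of_apply_eq ((hφ.hasMFDerivAt q hq).mul' (hψ.hasMFDerivAt q hq))
      fun v => ?_
    have h (b : W →L[ℂ] W) : φ q * (ψ q * b - b * ψ q) + (φ q * b - b * φ q) * ψ q =
        φ q * ψ q * b - b * (φ q * ψ q) := by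
      noncomm_ring
    exact h _
  apply_act q k hq := by
    simp only [Pi.mul_apply, hφ.apply_act q k hq, hψ.apply_act q k hq, mul_assoc,
      Units.mul_inv_cancel_left]

theorem IsFlatSection.const_smul {U : Set X} (hφ : S.IsFlatSection ℓ U φ) (c : ℂ) :
    S.IsFlatSection ℓ U (c • φ) where
  hasMFDerivAt q hq := by
    refine hasMFDerivAt_of_apply_eq ((hφ.hasMFDerivAt q hq).const_smul c) fun v => ?_
    have h (b : W →L[ℂ] W) : c • (φ q * b - b * φ q) = (c • φ q) * b - b * (c • φ q) := by
      rw [smul_sub, smul_mul_assoc, mul_smul_comm]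
    exact h _
  apply_act q k hq := by
    simp only [Pi.smul_apply, hφ.apply_act q k hq, mul_smul_comm, smul_mul_assoc]

theorem IsFlatSection.mdifferentiable (hφ : S.IsFlatSection ℓ univ φ) :
    MDifferentiable 𝓘(ℂ, (Fin d → ℂ) × F) 𝓘(ℂ, W →L[ℂ] W) φ := fun q =>
  (hφ.hasMFDerivAt q (mem_univ _)).mdifferentiableAt

theorem IsFlatSection.contMDiff [FiniteDimensional ℂ F] [CompleteSpace W]
    (hφ : S.IsFlatSection ℓ univ φ) :
    ContMDiff 𝓘(ℂ, (Fin d → ℂ) × F) 𝓘(ℂ, W →L[ℂ] W) ω φ :=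
  contMDiff_of_mdifferentiable hφ.mdifferentiable

/-- Two global flat sections which agree at one point are equal. -/
theorem IsFlatSection.eq_of_apply_eq [FiniteDimensional ℂ F] [CompleteSpace W]
    [PreconnectedSpace X] (hS : S.IsFlat) (hφ : S.IsFlatSection ℓ univ φ)
    (hψ : S.IsFlatSection ℓ univ ψ) {p₀ : S.bundle.Total} (h : φ p₀ = ψ p₀) : φ = ψ := by
  -- Agreement at one point of a fiber already puts its projection in the interior of `C`. Hence `C`
  -- is open, and its complement is the image under the open projection of the open locus of
  -- disagreement.
  let C : Set X := {x | ∀ q, S.bundle.proj q = x → φ q = ψ q}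
  have hC : ∀ q, φ q = ψ q → ∀ᶠ x in nhds (S.bundle.proj q), x ∈ C := fun q hq =>
    hφ.eventually_eq hS isOpen_univ hψ (mem_univ _) hq
  have hopen : IsOpen C := by
    refine isOpen_iff_mem_nhds.2 fun x hx => ?_
    obtain ⟨q, rfl⟩ := S.bundle.proj_surjective x
    exact hC q (hx q rfl)
  have hclosed : IsClosed C := by
    refine isOpen_compl_iff.1 (isOpen_iff_mem_nhds.2 fun x hx => ?_)
    obtain ⟨q, rfl, hq⟩ : ∃ q, S.bundle.proj q = x ∧ φ q ≠ ψ q := by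
      simpa [C] using hx
    have h1 : ∀ᶠ q' in nhds q, φ q' ≠ ψ q' :=
      (hφ.mdifferentiable.continuous.continuousAt.ne_iff_eventually_ne
        hψ.mdifferentiable.continuous.continuousAt).1 hq
    rw [← S.bundle.map_proj_nhds, mem_map]
    filter_upwards [h1] with q' hq' hC'
    exact hq' (hC' q' rfl)
  have huniv : C = univ := IsClopen.eq_univ ⟨hclosed, hopen⟩ ⟨_, (hC p₀ h).self_of_nhds⟩
  ext1 q
  exact (huniv.symm ▸ mem_univ (S.bundle.proj q) : S.bundle.proj q ∈ C) q rfl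

end BranchedCartanGeometry

end BranchedCartan

/-! ### Linear representations of the two structure groups -/

namespace BranchedCartan

open Set Filter

/-- An open embedding into a normed space is its own derivative in the chart which it defines. -/
theorem hasMFDerivAt_of_isOpenEmbedding {F H : Type*} [NormedAddCommGroup F] [NormedSpace ℂ F]
    [TopologicalSpace H] [Nonempty H] {f : H → F} (hf : Topology.IsOpenEmbedding f) (x : H) :
    letI := hf.singletonChartedSpace
    HasMFDerivAt 𝓘(ℂ, F) 𝓘(ℂ, F) f x (ContinuousLinearMap.id ℂ F) := by
  let _ := hf.singletonChartedSpace
  refine ⟨hf.continuous.continuousAt, ?_⟩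
  have h : writtenInExtChartAt 𝓘(ℂ, F) 𝓘(ℂ, F) x f =ᶠ[nhdsWithin (extChartAt 𝓘(ℂ, F) x x)
      (range 𝓘(ℂ, F))] id := by
    refine mem_nhdsWithin_of_mem_nhds ?_
    have : extChartAt 𝓘(ℂ, F) x x = f x := rfl
    rw [this]
    filter_upwards [hf.isOpen_range.mem_nhds (mem_range_self x)] with y hy
    exact (hf.toOpenPartialHomeomorph f).right_inv (by simpa using hy)
  exact (hasFDerivWithinAt_id _ _).congr_of_eventuallyEq h
    ((hf.toOpenPartialHomeomorph f).right_inv (by simp : f x ∈ _))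

noncomputable section

/-- The representation of `GL(d, ℂ)` which linearizes the affine model. -/
def affineLinearization (d : ℕ) : Linearization (affineModel d) where
  rep := affineRep d
  Ad_eq _ _ := by
    rw [← map_inv]
    rfl
  repDeriv := LinearMap.toContinuousLinearMap (affineModel d).incl
  hasMFDerivAt_rep := by
    have h1 : HasMFDerivAt 𝓘(ℂ, V d →L[ℂ] V d) 𝓘(ℂ, V d →L[ℂ] V d)
        (fun h : GLV d => (h : V d →L[ℂ] V d)) 1 (ContinuousLinearMap.id ℂ (V d →L[ℂ] V d)) :=
      hasMFDerivAt_of_isOpenEmbedding Units.isOpenEmbedding_val 1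
    have h2 : HasFDerivAt (fun A => block 1 0 0 0 +
        LinearMap.toContinuousLinearMap (affineModel d).incl A) _ ((1 : GLV d) : V d →L[ℂ] V d) :=
      ((LinearMap.toContinuousLinearMap (affineModel d).incl).hasFDerivAt).const_add _
    have h3 := h2.hasMFDerivAt.comp (1 : GLV d) h1
    have h4 : (fun A => block 1 0 0 0 +
        LinearMap.toContinuousLinearMap (affineModel d).incl A) ∘
          (fun h : GLV d => (h : V d →L[ℂ] V d)) = fun h => (affineRep d h : W d →L[ℂ] W d) := by
      ext h w i <;> simp [affineModel, affineRep]
    rw [h4] at h3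
    exact hasMFDerivAt_of_apply_eq h3 fun v => rfl
  commutator_repDeriv _ _ := rfl

/-- Representatives normalized to fix `(1, 0)` are closed under multiplication; this is what lifts
the parabolic subgroup from `PGL(d+1, ℂ)` to `GL(d+1, ℂ)` as a group. -/
theorem upper_mul_upper_mem {d : ℕ} (y z : (V d →L[ℂ] ℂ) × GLV d) :
    ∃ b A, upper y.1 y.2 * upper z.1 z.2 = upper b A :=
  exists_upper _ (by simp [upper_apply])

theorem parabolicMk_apply (d : ℕ) (q : Q d) : parabolicMk d ((parabolicEquiv d).symm q) = q :=
  (parabolicEquiv d).apply_symm_apply q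

/-- The representation `!![1, b; 0, A]` of the parabolic subgroup, on `ℂ^(d+1)`. -/
def parabolicRep (d : ℕ) : Q d →* GLW d where
  toFun q := upper ((parabolicEquiv d).symm q).1 ((parabolicEquiv d).symm q).2
  map_one' := by
    have h : (1 : Q d) = parabolicEquiv d (0, 1) := by
      have h1 : (upper 0 1 : GLW d) = 1 := Units.ext (by ext w i <;> simp [upper_apply])
      refine Subtype.ext ?_
      change (1 : PGLW d) = QuotientGroup.mk' (scalars d) (upper 0 1)
      rw [h1, map_one]
    rw [h, Equiv.symm_apply_apply]
    exact Units.ext (by ext w i <;> simp [upper_apply])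
  map_mul' q r := by
    obtain ⟨b, A, h⟩ := upper_mul_upper_mem ((parabolicEquiv d).symm q) ((parabolicEquiv d).symm r)
    have h1 : q * r = parabolicEquiv d (b, A) := by
      conv_lhs => rw [← parabolicMk_apply d q, ← parabolicMk_apply d r]
      refine Subtype.ext ?_
      change QuotientGroup.mk' (scalars d) _ * QuotientGroup.mk' (scalars d) _ =
        QuotientGroup.mk' (scalars d) (upper b A)
      rw [← map_mul, h]
    rw [h1, Equiv.symm_apply_apply, h]

/-- Because of this, the value of a flat section at `(1, 0)` transforms by the inverse
representation alone. -/
theorem parabolicRep_basis {d : ℕ} (q : Q d) :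
    (parabolicRep d q : W d →L[ℂ] W d) (1, 0) = (1, 0) := by
  simp [parabolicRep, upper_apply]

/-- The representation of the parabolic subgroup which linearizes the projective model. -/
def projectiveLinearization (d : ℕ) : Linearization (projectiveModel d) where
  rep := parabolicRep d
  Ad_eq q M := by
    conv_lhs => rw [← parabolicMk_apply d q]
    rfl
  repDeriv := LinearMap.toContinuousLinearMap (upperDeriv d)
  hasMFDerivAt_rep := by
    have h1 : HasMFDerivAt 𝓘(ℂ, (V d →L[ℂ] ℂ) × (V d →L[ℂ] V d))
        𝓘(ℂ, (V d →L[ℂ] ℂ) × (V d →L[ℂ] V d))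
        (fun q : Q d => ((((parabolicEquiv d).symm q).1, (((parabolicEquiv d).symm q).2 :
          V d →L[ℂ] V d)) : (V d →L[ℂ] ℂ) × (V d →L[ℂ] V d))) 1
        (ContinuousLinearMap.id ℂ ((V d →L[ℂ] ℂ) × (V d →L[ℂ] V d))) :=
      hasMFDerivAt_of_isOpenEmbedding (isOpenEmbedding_coord d) 1
    have h2 : HasFDerivAt (fun y => block 1 0 0 0 +
        LinearMap.toContinuousLinearMap (upperDeriv d) y) _
        ((((parabolicEquiv d).symm (1 : Q d)).1, (((parabolicEquiv d).symm (1 : Q d)).2 :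
          V d →L[ℂ] V d)) : (V d →L[ℂ] ℂ) × (V d →L[ℂ] V d)) :=
      ((LinearMap.toContinuousLinearMap (upperDeriv d)).hasFDerivAt).const_add _
    have h3 := h2.hasMFDerivAt.comp (1 : Q d) h1
    have h4 : (fun y => block 1 0 0 0 + LinearMap.toContinuousLinearMap (upperDeriv d) y) ∘
        (fun q : Q d => ((((parabolicEquiv d).symm q).1, (((parabolicEquiv d).symm q).2 :
          V d →L[ℂ] V d)) : (V d →L[ℂ] ℂ) × (V d →L[ℂ] V d))) =
        fun q => (parabolicRep d q : W d →L[ℂ] W d) := by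
      ext q w i <;> simp [upperDeriv, parabolicRep, upper_apply]
    rw [h4] at h3
    exact hasMFDerivAt_of_apply_eq h3 fun v => rfl
  commutator_repDeriv M y := by
    -- Passing to the trace-free part subtracts a scalar operator, which commutes with `M`.
    change commutator M (upperDeriv d y) = commutator M (upperDeriv d y -
      (LinearMap.trace ℂ (W d) (upperDeriv d y) / (d + 1)) • 1)
    rw [map_sub, map_smul, commutator_apply M 1, mul_one, one_mul, sub_self, smul_zero, sub_zero]

end

/-! ### Nonexistence of affine structures -/

open BranchedCartanGeometry

/-- A compact simply connected complex manifold of positive dimension has no branched flat affine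
structure. -/
theorem not_isFlat_of_branchedAffineStructure {d : ℕ} (hd : 1 ≤ d) {X : Type u}
    [TopologicalSpace X] [ChartedSpace (Fin d → ℂ) X] [IsManifold 𝓘(ℂ, Fin d → ℂ) ω X]
    [CompactSpace X] [SimplyConnectedSpace X] (S : BranchedAffineStructure.{u, v} d X) :
    ¬ S.IsFlat := by
  intro hS
  obtain ⟨U, -, ⟨x₀, hx₀⟩, hiso⟩ := S.generically_iso
  obtain ⟨p₀, rfl⟩ := S.bundle.proj_surjective x₀
  let i : Fin d := ⟨0, hd⟩
  -- The initial value is `(s, y) ↦ (y i, 0)`, so that `Λ (φ q)` below plays the role of the `i`-th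
  -- coordinate of the developing map.
  obtain ⟨φ, hφ, hφ0⟩ := exists_isFlatSection_univ (affineLinearization d) hS p₀
    (block 0 (ContinuousLinearMap.proj i) 0 0)
  let Λ : (W d →L[ℂ] W d) →L[ℂ] ℂ :=
    (ContinuousLinearMap.fst ℂ ℂ (V d)).comp (ContinuousLinearMap.apply ℂ (W d) ((1, 0) : W d))
  -- The linear group fixes both the vector `(1, 0)` and the first coordinate functional.
  have hact : ∀ q k, Λ (φ (S.bundle.act q k)) = Λ (φ q) := by
    intro q k
    rw [hφ.apply_act q k (mem_univ _)]
    simp [Λ, affineLinearization, affineRep]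
  have hΛ : ∀ q, HasMFDerivAt 𝓘(ℂ, (Fin d → ℂ) × (V d →L[ℂ] V d)) 𝓘(ℂ, ℂ) (fun q => Λ (φ q)) q
      (Λ.comp ((commutator (φ q)).comp (S.form q))) := fun q =>
    Λ.hasMFDerivAt.comp q (hφ.hasMFDerivAt q (mem_univ _))
  choose p hp using S.bundle.proj_surjective
  let f : X → ℂ := fun x => Λ (φ (p x))
  have hf : ∀ q, f (S.bundle.proj q) = Λ (φ q) := by
    intro q
    obtain ⟨k, hk⟩ := S.bundle.exists_act_eq (hp (S.bundle.proj q))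
    rw [hk, hact]
    simp only [← hk]
    rfl
  have hfd : MDifferentiable 𝓘(ℂ, Fin d → ℂ) 𝓘(ℂ, ℂ) f := by
    intro x
    obtain ⟨e, hx, -, he2, -⟩ := S.bundle.locallyTrivial x
    have h1 : MDifferentiableAt (𝓘(ℂ, Fin d → ℂ).prod 𝓘(ℂ, V d →L[ℂ] V d))
        𝓘(ℂ, (Fin d → ℂ) × (V d →L[ℂ] V d)) e.toOpenPartialHomeomorph.symm (x, 1) :=
      (he2.contMDiffAt (e.open_target.mem_nhds (e.mem_target.2 hx))).mdifferentiableAt (by simp)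
    have h2 := h1.comp (f := fun y : X => (y, (1 : GLV d))) x
      (mdifferentiableAt_id.prodMk mdifferentiableAt_const)
    have h3 := (hΛ (e.toOpenPartialHomeomorph.symm (x, 1))).mdifferentiableAt.comp x h2
    refine h3.congr_of_eventuallyEq ?_
    filter_upwards [e.open_baseSet.mem_nhds hx] with y hy
    simp only [Function.comp_apply]
    rw [← hf, e.proj_symm_apply' hy]
  -- Holomorphic functions on a compact connected manifold are constant.
  have hconst : ∀ q, Λ (φ q) = Λ (φ p₀) := fun q => by
    rw [← hf, ← hf]
    exact hfd.apply_eq_of_compactSpace _ _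
  have hzero : HasMFDerivAt 𝓘(ℂ, (Fin d → ℂ) × (V d →L[ℂ] V d)) 𝓘(ℂ, ℂ) (fun q => Λ (φ q)) p₀
      (0 : (Fin d → ℂ) × (V d →L[ℂ] V d) →L[ℂ] ℂ) := by
    have h : (fun q => Λ (φ q)) = fun _ => Λ (φ p₀) := funext hconst
    rw [h]
    exact hasMFDerivAt_const _ _
  have huniq := hasMFDerivAt_unique (hΛ p₀) hzero
  -- The infinitesimal translation along the `i`-th axis: `Λ` takes the value `1` on the commutator
  -- of `φ p₀` with it, against the vanishing derivative.
  have hmem : block 0 0 (Pi.single i 1) 0 ∈ (affineModel d).lieAlg := fun w => by simp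
  obtain ⟨v, hv⟩ : block 0 0 (Pi.single i 1) 0 ∈ range (S.form p₀) := by
    rw [(hiso p₀ hx₀).2]
    exact hmem
  have h1 : Λ (commutator (φ p₀) (S.form p₀ v)) = 0 := DFunLike.congr_fun huniq v
  rw [hv, hφ0, commutator_apply] at h1
  simp [Λ] at h1

end BranchedCartan

/-! ### Rank one operators, polynomial relations and density -/

namespace BranchedCartan

open Set Filter BranchedCartanGeometry

/-- An operator `P` such that `P M P` is always a multiple of `P` has rank at most one. -/
theorem exists_apply_eq_smul {W : Type*} [NormedAddCommGroup W] [NormedSpace ℂ W] {P : W →L[ℂ] W}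
    (hP : ∀ M : W →L[ℂ] W, ∃ c : ℂ, P * M * P = c • P) {w : W} (hw : P w ≠ 0) (v : W) :
    ∃ c : ℂ, P v = c • P w := by
  obtain ⟨ξ, hξ⟩ := SeparatingDual.exists_eq_one (R := ℂ) hw
  -- For `M = ξ ⊗ v` with `ξ (P w) = 1`, the operator `P M P` sends `w` to `P v`.
  obtain ⟨c, hc⟩ := hP (ξ.smulRight v)
  refine ⟨c, ?_⟩
  have h := congrArg (fun A : W →L[ℂ] W => A w) hc
  simpa [hξ] using h

/-- Turns an algebraic relation between classes of functions into a polynomial relation between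
values on a dense open set. -/
theorem aeval_germ {d : ℕ} {X : Type u} [TopologicalSpace X] (f : Fin d → X → ℂ)
    (P : MvPolynomial (Fin d) ℂ) :
    MvPolynomial.aeval (fun j => ((f j : X → ℂ) : (denseOpens X).Germ ℂ)) P =
      ((fun x => MvPolynomial.eval (fun j => f j x) P : X → ℂ) : (denseOpens X).Germ ℂ) := by
  induction P using MvPolynomial.induction_on with
  | C a =>
    rw [MvPolynomial.aeval_C, Algebra.algebraMap_eq_smul_one, ← Filter.Germ.coe_one,
      ← Filter.Germ.coe_smul]
    congr 1
    ext x
    simp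
  | add P Q hP hQ =>
    rw [map_add, hP, hQ, ← Filter.Germ.coe_add]
    congr 1
    ext x
    simp
  | mul_X P j hP =>
    rw [map_mul, hP, MvPolynomial.aeval_X, ← Filter.Germ.coe_mul]
    congr 1
    ext x
    simp

/-- A polynomial which vanishes near a point is zero. -/
theorem mvPolynomial_eq_zero_of_eventually {d : ℕ} {P : MvPolynomial (Fin d) ℂ} {z : Fin d → ℂ}
    (h : ∀ᶠ y in nhds z, MvPolynomial.eval y P = 0) : P = 0 := by
  obtain ⟨r, hr, hball⟩ := Metric.eventually_nhds_iff_ball.1 h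
  refine MvPolynomial.funext_set (fun i => Metric.ball (z i) r)
    (fun i => infinite_of_mem_nhds (z i) (Metric.ball_mem_nhds _ hr))
    fun y hy => ?_
  rw [map_zero]
  refine hball y ?_
  rw [Metric.mem_ball, dist_pi_lt_iff hr]
  exact fun i => hy i (mem_univ i)

/-- The operator is `fst ⊗ (0, x)`, with trace `fst (0, x) = 0`. Such directions are therefore
values of `β` at points where it is onto the Lie algebra. -/
theorem block_mem_projLieAlg {d : ℕ} (x : V d) : block 0 0 x 0 ∈ projLieAlg d := by
  have h : ((block 0 0 x 0 : W d →L[ℂ] W d) : W d →ₗ[ℂ] W d) =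
      (LinearMap.fst ℂ ℂ (V d)).smulRight (0, x) := by
    ext w <;> simp
  change LinearMap.trace ℂ (W d) ((block 0 0 x 0 : W d →L[ℂ] W d) : W d →ₗ[ℂ] W d) = 0
  rw [h, LinearMap.trace_smulRight]
  simp

/-- If the dense set `D` is saturated, and a holomorphic map `T` is a submersion at `p`, then
a polynomial which vanishes on the image of `D` under `T` is zero. -/
theorem mvPolynomial_eq_zero_of_submersion {d : ℕ} {N M : Type*} [NormedAddCommGroup N]
    [NormedSpace ℂ N] [CompleteSpace N] [TopologicalSpace M] [ChartedSpace N M]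
    [IsManifold 𝓘(ℂ, N) ω M] {T : M → Fin d → ℂ} {p : M}
    (hT : ∀ᶠ q in nhds p, ContMDiffAt 𝓘(ℂ, N) 𝓘(ℂ, Fin d → ℂ) ω T q)
    {L : TangentSpace 𝓘(ℂ, N) p →L[ℂ] (Fin d → ℂ)}
    (hL : HasMFDerivAt 𝓘(ℂ, N) 𝓘(ℂ, Fin d → ℂ) T p L) (hs : Function.Surjective L)
    {D : Set M} (hD : Dense D) {P : MvPolynomial (Fin d) ℂ}
    (hP : ∀ᶠ q in nhds p, q ∈ D → MvPolynomial.eval (T q) P = 0) : P = 0 := by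
  set e := chartAt N p with he
  have hp : p ∈ e.source := mem_chart_source _ p
  -- Continuity extends the vanishing from the dense set to a neighborhood.
  have hzero : ∀ᶠ q in nhds p, MvPolynomial.eval (T q) P = 0 := by
    filter_upwards [(hT.and hP).eventually_nhds] with q hq
    by_contra hne
    have hc : ContinuousAt (fun q => MvPolynomial.eval (T q) P) q :=
      (MvPolynomial.continuous_eval P).continuousAt.comp hq.self_of_nhds.1.continuousAt
    obtain ⟨q', hq'D, hq'⟩ := (mem_closure_iff_nhds.1 (hD q)) _
      (inter_mem (hc.eventually_ne hne) hq) |>.imp fun _ h => h.symm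
    exact hq'.1 (hq'.2.2 hq'D)
  have hsymm : ContMDiffAt 𝓘(ℂ, N) 𝓘(ℂ, N) ω e.symm (e p) :=
    (contMDiffOn_chart_symm (I := 𝓘(ℂ, N)) (n := ω) (x := p)).contMDiffAt
      (e.open_target.mem_nhds (e.map_source hp))
  have hTc : ContDiffAt ℂ ω (T ∘ e.symm) (e p) := by
    refine ContMDiffAt.contDiffAt (ContMDiffAt.comp (e p) ?_ hsymm)
    rw [e.left_inv hp]
    exact hT.self_of_nhds
  have hstrict : HasStrictFDerivAt (T ∘ e.symm) (fderiv ℂ (T ∘ e.symm) (e p)) (e p) :=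
    hTc.hasStrictFDerivAt (by simp)
  have hsurj : (fderiv ℂ (T ∘ e.symm) (e p)).range = ⊤ := by
    rw [LinearMap.range_eq_top]
    intro y
    obtain ⟨v, rfl⟩ := hs y
    have h1 := hstrict.hasFDerivAt.hasMFDerivAt.comp p
      ((mdifferentiable_chart (I := 𝓘(ℂ, N)) p).mdifferentiableAt hp).hasMFDerivAt
    have h2 : T =ᶠ[nhds p] (T ∘ e.symm) ∘ e := by
      filter_upwards [e.open_source.mem_nhds hp] with q hq
      simp [e.left_inv hq]
    have h3 := hasMFDerivAt_unique (h1.congr_of_eventuallyEq h2) hL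
    exact ⟨_, DFunLike.congr_fun h3 v⟩
  -- A submersion maps neighborhoods onto neighborhoods, so the polynomial vanishes on an open set
  -- of `ℂ^d`.
  have hmap := hstrict.map_nhds_eq_of_surj hsurj
  refine mvPolynomial_eq_zero_of_eventually (z := (T ∘ e.symm) (e p)) ?_
  rw [← hmap, eventually_map]
  have ht : Tendsto e.symm (nhds (e p)) (nhds p) := by
    have := hsymm.continuousAt
    rwa [ContinuousAt, e.left_inv hp] at this
  exact ht.eventually hzero

section

variable {d : ℕ} {X : Type u} [TopologicalSpace X] [ChartedSpace (Fin d → ℂ) X]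
  {S : BranchedProjectiveStructure.{u, v} d X}

/-- The value of a flat section on the first basis vector transforms by the linear
representation. -/
theorem isFlatSection_apply_act {φ : S.bundle.Total → (W d →L[ℂ] W d)}
    (hφ : S.IsFlatSection (projectiveLinearization d) univ φ) (q : S.bundle.Total) (k : Q d) :
    φ (S.bundle.act q k) (1, 0) =
      (↑(parabolicRep d k)⁻¹ : W d →L[ℂ] W d) (φ q (1, 0)) := by
  rw [hφ.apply_act q k (mem_univ _)]
  change (↑(parabolicRep d k)⁻¹ * φ q * parabolicRep d k : W d →L[ℂ] W d) (1, 0) = _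
  rw [mul_apply_eq_comp, mul_apply_eq_comp, parabolicRep_basis]

theorem isFlatSection_apply_act_eq_zero_iff {φ : S.bundle.Total → (W d →L[ℂ] W d)}
    (hφ : S.IsFlatSection (projectiveLinearization d) univ φ) (q : S.bundle.Total) (k : Q d) :
    φ (S.bundle.act q k) (1, 0) = 0 ↔ φ q (1, 0) = 0 := by
  rw [isFlatSection_apply_act hφ]
  refine ⟨fun h => ?_, fun h => by rw [h, map_zero]⟩
  have := congrArg (parabolicRep d k : W d →L[ℂ] W d) h
  rwa [← mul_apply_eq_comp, Units.mul_inv, one_apply_eq_self, map_zero] at this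

/-- The points where a nonzero flat section does not annihilate the first basis vector form a dense
open subset. -/
theorem dense_isFlatSection_ne_zero [PreconnectedSpace X]
    {φ : S.bundle.Total → (W d →L[ℂ] W d)}
    (hφ : S.IsFlatSection (projectiveLinearization d) univ φ) {p₀ : S.bundle.Total}
    (h0 : φ p₀ (1, 0) ≠ 0) :
    ∃ D : Set X, IsOpen D ∧ Dense D ∧ ∀ q, S.bundle.proj q ∈ D ↔ φ q (1, 0) ≠ 0 := by
  have hc : ContMDiff 𝓘(ℂ, (Fin d → ℂ) × _) 𝓘(ℂ, W d) ω (fun q => φ q (1, 0)) :=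
    (ContinuousLinearMap.apply ℂ (W d) ((1, 0) : W d)).contMDiff.comp hφ.contMDiff
  have hopen : IsOpenMap S.bundle.proj :=
    IsOpenMap.of_nhds_le fun q => (S.bundle.map_proj_nhds q).ge
  have hquot : Topology.IsQuotientMap S.bundle.proj :=
    hopen.isQuotientMap S.bundle.continuous_proj S.bundle.proj_surjective
  let D : Set X := {x | ∃ q, S.bundle.proj q = x ∧ φ q (1, 0) ≠ 0}
  have hD : ∀ q, S.bundle.proj q ∈ D ↔ φ q (1, 0) ≠ 0 := by
    refine fun q => ⟨?_, fun h => ⟨q, rfl, h⟩⟩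
    rintro ⟨q', hq', h⟩
    obtain ⟨k, rfl⟩ := S.bundle.exists_act_eq hq'
    rwa [Ne, isFlatSection_apply_act_eq_zero_iff hφ]
  have hDpre : S.bundle.proj ⁻¹' D = {q | φ q (1, 0) ≠ 0} := Set.ext hD
  -- The complement of the closure of `D`. It is closed by the identity theorem and clearly open,
  -- and it misses the projection of `p₀`, hence is empty by connectedness.
  let C : Set X := {x | ∃ q, S.bundle.proj q = x ∧ ∀ᶠ q' in nhds q, φ q' (1, 0) = 0}
  have hC : S.bundle.proj ⁻¹' C = {q | ∀ᶠ q' in nhds q, φ q' (1, 0) = 0} := by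
    refine Set.ext fun q => ⟨?_, fun h => ⟨q, rfl, h⟩⟩
    rintro ⟨q', hq', h⟩
    obtain ⟨k, rfl⟩ := S.bundle.exists_act_eq hq'.symm
    have h1 := (S.bundle.continuous_act k).continuousAt.eventually h
    exact h1.mono fun y hy => (isFlatSection_apply_act_eq_zero_iff hφ y k).1 hy
  have hCclopen : IsClopen C := by
    constructor
    · rw [← hquot.isClosed_preimage, hC]
      exact isClosed_setOf_eventually_eq_zero hc
    · rw [← hquot.isOpen_preimage, hC]
      exact isOpen_setOfPred_eventually_nhds
  have hCe : C = ∅ := by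
    by_contra hne
    have := hCclopen.eq_univ (nonempty_iff_ne_empty.2 hne)
    have h1 : p₀ ∈ S.bundle.proj ⁻¹' C := by rw [this]; trivial
    rw [hC] at h1
    exact h0 h1.self_of_nhds
  refine ⟨D, ?_, ?_, hD⟩
  · rw [← hquot.isOpen_preimage, hDpre]
    exact isOpen_ne_fun hc.continuous continuous_const
  · refine dense_iff_inter_open.2 fun O hO ⟨x, hx⟩ => ?_
    obtain ⟨q, rfl⟩ := S.bundle.proj_surjective x
    have h1 : ¬ ∀ᶠ q' in nhds q, φ q' (1, 0) = 0 := by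
      intro h
      have : q ∈ S.bundle.proj ⁻¹' C := by rw [hC]; exact h
      rw [hCe] at this
      exact this
    obtain ⟨q', hq', hq'O⟩ := ((not_eventually.1 h1).and_eventually
      ((hO.preimage S.bundle.continuous_proj).mem_nhds hx)).exists
    exact ⟨S.bundle.proj q', hq'O, (hD q').2 hq'⟩

end

end BranchedCartan

/-! ### Meromorphic coordinates of the developing map -/

namespace BranchedCartan

open Set Filter BranchedCartanGeometry

/-- A ratio of flat sections, the denominator of which has rank one everywhere, is meromorphic. -/
theorem isMeromorphic_of_flat_ratio {d : ℕ} {X : Type u} [TopologicalSpace X]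
    [ChartedSpace (Fin d → ℂ) X] {S : BranchedProjectiveStructure.{u, v} d X}
    {P φ : S.bundle.Total → (W d →L[ℂ] W d)}
    (hP : S.IsFlatSection (projectiveLinearization d) univ P)
    (hφ : S.IsFlatSection (projectiveLinearization d) univ φ)
    (hP0 : ∀ q, P q ≠ 0) (hrank : ∀ q v w, P q w ≠ 0 → ∃ c : ℂ, P q v = c • P q w)
    {D : Set X} (hDo : IsOpen D) (hDd : Dense D)
    (hD : ∀ q, S.bundle.proj q ∈ D ↔ P q (1, 0) ≠ 0) {f : X → ℂ}
    (hf : ∀ q, P q (1, 0) ≠ 0 → φ q (1, 0) = f (S.bundle.proj q) • P q (1, 0)) :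
    IsMeromorphic d f := by
  intro x
  obtain ⟨e, hx, -, he2, -⟩ := S.bundle.locallyTrivial x
  let s : X → S.bundle.Total := fun x => e.toOpenPartialHomeomorph.symm (x, 1)
  have hs_proj : ∀ y ∈ e.baseSet, S.bundle.proj (s y) = y := fun y hy => e.proj_symm_apply' hy
  have hs : ContMDiffOn 𝓘(ℂ, Fin d → ℂ) 𝓘(ℂ, (Fin d → ℂ) × _) ω s e.baseSet :=
    he2.comp (contMDiffOn_id.prodMk contMDiffOn_const) fun y hy => e.mem_target.2 hy
  obtain ⟨w, hw⟩ : ∃ w, P (s x) w ≠ 0 := by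
    by_contra! h
    exact hP0 (s x) (ContinuousLinearMap.ext h)
  obtain ⟨ξ, hξ⟩ := SeparatingDual.exists_ne_zero (R := ℂ) hw
  have heval : ∀ (χ : S.bundle.Total → (W d →L[ℂ] W d)),
      S.IsFlatSection (projectiveLinearization d) univ χ → ∀ v : W d,
      ContMDiffOn 𝓘(ℂ, Fin d → ℂ) 𝓘(ℂ, ℂ) ω (fun y => ξ (χ (s y) v)) e.baseSet := by
    intro χ hχ v
    exact (ξ.comp (ContinuousLinearMap.apply ℂ (W d) v)).contMDiff.comp_contMDiffOn
      (hχ.contMDiff.comp_contMDiffOn hs)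
  -- Over `U` the functional `ξ` is injective on the line that is the image of `P (s y)`. The scalar
  -- denominator therefore vanishes only where `P (s y) (1, 0)` does, i.e. off the dense set `D`.
  let U : Set X := e.baseSet ∩ (fun y => ξ (P (s y) w)) ⁻¹' {0}ᶜ
  have hU : IsOpen U :=
    (heval P hP w).continuousOn.isOpen_inter_preimage e.open_baseSet isOpen_compl_singleton
  refine ⟨U, hU, ⟨hx, hξ⟩, fun y => ξ (φ (s y) (1, 0)), fun y => ξ (P (s y) (1, 0)),
    (heval φ hφ _).mono inter_subset_left, (heval P hP _).mono inter_subset_left, ?_, ?_⟩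
  · refine (hDd.open_subset_closure_inter hU).trans (closure_mono ?_)
    rintro y ⟨hyU, hyD⟩
    refine ⟨hyU, fun h0 => ?_⟩
    have h1 : P (s y) (1, 0) ≠ 0 := (hD _).1 (by rwa [hs_proj y hyU.1])
    have h2 : P (s y) w ≠ 0 := fun h => hyU.2 (by simp [h])
    obtain ⟨c, hc⟩ := hrank (s y) (1, 0) w h2
    change ξ (P (s y) (1, 0)) = 0 at h0
    rw [hc, map_smul, smul_eq_mul, mul_eq_zero] at h0
    rcases h0 with h0 | h0
    · exact h1 (by rw [hc, h0, zero_smul])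
    · exact hyU.2 h0
  · refine ⟨D, hDo, hDd, fun y hyD hyU => ?_⟩
    have h1 := hf (s y) ((hD _).1 (by rwa [hs_proj y hyU.1]))
    rw [hs_proj y hyU.1] at h1
    change f y * ξ (P (s y) (1, 0)) = ξ (φ (s y) (1, 0))
    rw [h1, map_smul, smul_eq_mul]

/-- A compact simply connected complex manifold with a branched flat projective structure is
Moishezon. -/
theorem isMoishezon_of_branchedProjectiveStructure {d : ℕ} {X : Type u}
    [TopologicalSpace X] [ChartedSpace (Fin d → ℂ) X] [SimplyConnectedSpace X]
    (S : BranchedProjectiveStructure.{u, v} d X) (hS : S.IsFlat) : IsMoishezon d X := by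
  obtain ⟨U, -, ⟨x₀, hx₀⟩, hiso⟩ := S.generically_iso
  obtain ⟨p₀, rfl⟩ := S.bundle.proj_surjective x₀
  choose Φ hΦ hΦ0 using exists_isFlatSection_univ (projectiveLinearization d) hS p₀
  let ξ₀ : W d →L[ℂ] ℂ := ContinuousLinearMap.fst ℂ ℂ (V d)
  -- Operators of rank at most one with image in the line of `(1, 0)`; `r ξ₀` is the projection onto
  -- that line.
  let r : (W d →L[ℂ] ℂ) → (W d →L[ℂ] W d) := fun ξ => ξ.smulRight (1, 0)
  let P := Φ (r ξ₀)
  have hP : S.IsFlatSection (projectiveLinearization d) univ P := hΦ _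
  have hPp : P p₀ = r ξ₀ := hΦ0 _
  have hPmul : ∀ ξ, P * Φ (r ξ) = Φ (r ξ) := by
    intro ξ
    refine (hP.mul (hΦ _)).eq_of_apply_eq hS (hΦ _) (p₀ := p₀) ?_
    rw [Pi.mul_apply, hPp, hΦ0]
    ext w <;> simp [r, ξ₀]
  have hP0 : ∀ q, P q ≠ 0 := by
    intro q hq
    have h1 : (0 : ℂ) • P = P :=
      (hP.const_smul 0).eq_of_apply_eq hS hP (p₀ := q) (by simp [hq])
    have h2 := congrFun h1 p₀
    rw [zero_smul, Pi.zero_apply, hPp] at h2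
    have h3 := congrArg (fun A : W d →L[ℂ] W d => (A (1, 0)).1) h2
    simp [r, ξ₀] at h3
  -- To move the rank one property from `p₀` to `q`, the operator `M` is extended to a flat section
  -- `χ`; the scalar is then computed at `p₀`, where `P` is a rank one projection.
  have hPMP : ∀ q, ∀ M : W d →L[ℂ] W d, ∃ c : ℂ, P q * M * P q = c • P q := by
    intro q M
    obtain ⟨χ, hχ, rfl⟩ := exists_isFlatSection_univ (projectiveLinearization d) hS q M
    refine ⟨(χ p₀ (1, 0)).1, ?_⟩
    have h1 : P * χ * P = (χ p₀ (1, 0)).1 • P := by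
      refine ((hP.mul hχ).mul hP).eq_of_apply_eq hS (hP.const_smul _) (p₀ := p₀) ?_
      rw [Pi.mul_apply, Pi.mul_apply, Pi.smul_apply, hPp]
      refine ContinuousLinearMap.ext fun w => ?_
      change (χ p₀ (w.1 • ((1, 0) : W d))).1 • ((1, 0) : W d) =
        (χ p₀ (1, 0)).1 • w.1 • ((1, 0) : W d)
      rw [map_smul, Prod.smul_fst, smul_eq_mul, smul_smul, mul_comm]
    exact congrFun h1 q
  have hrank : ∀ q v w, P q w ≠ 0 → ∃ c : ℂ, P q v = c • P q w := fun q v w hw =>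
    exists_apply_eq_smul (hPMP q) hw v
  obtain ⟨D, hDo, hDd, hD⟩ := dense_isFlatSection_ne_zero hP (p₀ := p₀) (by
    rw [hPp]
    simp [r, ξ₀])
  -- Since `P * Φ (r ξ) = Φ (r ξ)`, both vectors lie on the line that is the image of `P q`. They
  -- transform by the same operator along the fiber, so their ratio depends only on `x`. Where `P q
  -- (1, 0) = 0` the value is a dummy.
  have hex : ∀ ξ x, ∃ c : ℂ, ∀ q, S.bundle.proj q = x → P q (1, 0) ≠ 0 →
      Φ (r ξ) q (1, 0) = c • P q (1, 0) := by
    intro ξ x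
    obtain ⟨q, rfl⟩ := S.bundle.proj_surjective x
    by_cases hq : P q (1, 0) = 0
    · refine ⟨0, fun q' hq' h => ?_⟩
      obtain ⟨k, rfl⟩ := S.bundle.exists_act_eq hq'.symm
      exact (h ((isFlatSection_apply_act_eq_zero_iff hP q k).2 hq)).elim
    · obtain ⟨c, hc⟩ := hrank q (Φ (r ξ) q (1, 0)) (1, 0) hq
      refine ⟨c, fun q' hq' _ => ?_⟩
      obtain ⟨k, rfl⟩ := S.bundle.exists_act_eq hq'.symm
      rw [isFlatSection_apply_act (hΦ _), isFlatSection_apply_act hP, ← map_smul, ← hc]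
      congr 1
      exact (DFunLike.congr_fun (congrFun (hPmul ξ) q) (1, 0)).symm
  choose f hf using hex
  let ζ : Fin d → (W d →L[ℂ] ℂ) := fun j =>
    (ContinuousLinearMap.proj j).comp (ContinuousLinearMap.snd ℂ ℂ (V d))
  have hmero : ∀ j, IsMeromorphic d (f (ζ j)) := fun j =>
    isMeromorphic_of_flat_ratio hP (hΦ (r (ζ j))) hP0 hrank hDo hDd hD fun q hq =>
      hf (ζ j) _ q rfl hq
  refine ⟨fun j => ⟨_, f (ζ j), hmero j, rfl⟩, algebraicIndependent_iff.2 fun R hR => ?_⟩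
  have hR1 := congrArg (meromorphicFunctions d X).val hR
  rw [MvPolynomial.comp_aeval_apply, map_zero] at hR1
  have hR2 := (aeval_germ (fun j => f (ζ j)) R).symm.trans hR1
  rw [← Filter.Germ.coe_zero, Filter.Germ.coe_eq] at hR2
  obtain ⟨D', hD'o, hD'd, hD'⟩ := hR2
  -- the developing map in an affine chart of projective space
  let N := (Fin d → ℂ) × ((V d →L[ℂ] ℂ) × (V d →L[ℂ] V d))
  let ev : (W d →L[ℂ] W d) →L[ℂ] ℂ := ξ₀.comp (ContinuousLinearMap.apply ℂ (W d) ((1, 0) : W d))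
  -- Where `ev (P q) ≠ 0` and `q` lies over `D`, this is the tuple of meromorphic functions pulled
  -- back to the total space; unlike `f` it is visibly holomorphic near `p₀`.
  let T : S.bundle.Total → Fin d → ℂ := fun q j => (ev (P q))⁻¹ * ev (Φ (r (ζ j)) q)
  have hev0 : ev (P p₀) = 1 := by
    simp [hPp, ev, r, ξ₀]
  have hevj : ∀ j, ev (Φ (r (ζ j)) p₀) = 0 := by
    intro j
    simp [hΦ0, ev, r, ξ₀, ζ]
  have hev : ∀ χ : S.bundle.Total → (W d →L[ℂ] W d),
      S.IsFlatSection (projectiveLinearization d) univ χ →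
      ContMDiff 𝓘(ℂ, N) 𝓘(ℂ, ℂ) ω fun q => ev (χ q) := fun χ hχ =>
    ev.contMDiff.comp hχ.contMDiff
  have hne : ∀ᶠ q in nhds p₀, ev (P q) ≠ 0 :=
    (hev P hP).continuous.continuousAt.eventually_ne (by rw [hev0]; exact one_ne_zero)
  let L : N →L[ℂ] (Fin d → ℂ) := ContinuousLinearMap.pi fun j => (ζ j).comp
    ((ContinuousLinearMap.apply ℂ (W d) ((1, 0) : W d)).comp (S.form p₀))
  refine mvPolynomial_eq_zero_of_submersion (T := T) (p := p₀) (N := N) (L := L) (D :=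
    S.bundle.proj ⁻¹' (D ∩ D')) ?_ ?_ ?_ ?_ ?_
  · filter_upwards [hne] with q hq
    refine contMDiffAt_pi_space.2 fun j => ?_
    exact ((contDiffAt_inv ℂ hq).contMDiffAt.comp q (hev P hP q)).mul (hev _ (hΦ _) q)
  · have hd (χ : S.bundle.Total → (W d →L[ℂ] W d))
        (hχ : S.IsFlatSection (projectiveLinearization d) univ χ) :=
      ev.hasFDerivAt.hasMFDerivAt.comp p₀ (hχ.hasMFDerivAt p₀ (mem_univ _))
    have hj : ∀ j, HasMFDerivAt 𝓘(ℂ, N) 𝓘(ℂ, ℂ) (fun q => T q j) p₀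
        ((ContinuousLinearMap.proj j : (Fin d → ℂ) →L[ℂ] ℂ).comp L) := by
      intro j
      -- At `p₀` the denominator is `1` and the numerator `0`, so only the numerator is
      -- differentiated. As `ζ j` kills `(1, 0)`, its derivative reduces to `ζ j` of `β v` applied
      -- to `(1, 0)`.
      have h1 : HasFDerivAt (fun z : ℂ × ℂ => z.1⁻¹ * z.2) (ContinuousLinearMap.snd ℂ ℂ ℂ)
          (ev (P p₀), ev (Φ (r (ζ j)) p₀)) := by
        rw [hev0, hevj]
        refine (((hasFDerivAt_inv (𝕜 := ℂ) one_ne_zero).comp ((1, 0) : ℂ × ℂ)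
          hasFDerivAt_fst).mul' hasFDerivAt_snd).congr_fderiv ?_
        ext <;> simp
      have h2 : HasMFDerivAt 𝓘(ℂ, N) 𝓘(ℂ, ℂ × ℂ)
          (fun q => (ev (P q), ev (Φ (r (ζ j)) q))) p₀ _ :=
        ⟨(hd P hP).1.prodMk (hd _ (hΦ _)).1, (hd P hP).2.prodMk (hd _ (hΦ _)).2⟩
      refine hasMFDerivAt_of_apply_eq
        (h1.hasMFDerivAt.comp p₀ h2) fun v => ?_
      change (commutator (Φ (r (ζ j)) p₀) (S.form p₀ v) (1, 0)).1 = ζ j (S.form p₀ v (1, 0))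
      rw [hΦ0, commutator_apply]
      simp [r, ζ]
    exact ⟨continuousAt_pi.2 fun j => (hj j).1, hasFDerivWithinAt_pi.2 fun j => (hj j).2⟩
  · intro y
    obtain ⟨v, hv⟩ : block 0 0 y 0 ∈ range (S.form p₀) := by
      rw [(hiso p₀ hx₀).2]
      exact block_mem_projLieAlg y
    refine ⟨v, funext fun j => ?_⟩
    change ζ j (S.form p₀ v (1, 0)) = y j
    rw [hv]
    simp [ζ]
  · exact (hDd.inter_of_isOpen_left hD'd hDo).preimage
      (IsOpenMap.of_nhds_le fun q => (S.bundle.map_proj_nhds q).ge)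
  · filter_upwards [hne] with q hq hqD
    have h1 := hD' hqD.2
    have h2 : (fun j => f (ζ j) (S.bundle.proj q)) = T q := by
      ext j
      have h3 := congrArg ξ₀ (hf (ζ j) _ q rfl ((hD q).1 hqD.1))
      rw [map_smul, smul_eq_mul] at h3
      simp only [T]
      rw [eq_inv_mul_iff_mul_eq₀ hq, mul_comm]
      exact h3.symm
    rw [← h2]
    exact h1

end BranchedCartan

theorem proposition3p2 (d : ℕ) (hd : 1 ≤ d) (X : Type u) [TopologicalSpace X] [T2Space X]
    [ChartedSpace (Fin d → ℂ) X] [IsManifold 𝓘(ℂ, Fin d → ℂ) ω X] [CompactSpace X]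
    [SimplyConnectedSpace X] :
    (¬ ∃ S : BranchedCartan.BranchedAffineStructure.{u, v} d X, S.IsFlat) ∧
    ((∃ S : BranchedCartan.BranchedProjectiveStructure.{u, v} d X, S.IsFlat) →
      BranchedCartan.IsMoishezon d X) :=
  ⟨fun ⟨S, hS⟩ => BranchedCartan.not_isFlat_of_branchedAffineStructure hd S hS,
    fun ⟨S, hS⟩ => BranchedCartan.isMoishezon_of_branchedProjectiveStructure S hS⟩
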